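/- **Setting.** A $d$-dimensional linear MDP $M$ consists of a horizon $H$, a (discrete) state space $\mathcal X$, a finite nonempty action set $\mathcal A$ with $A=|\mathcal A|$, an initial distribution on $\mathcal X$, feature maps $\phi_h:\mathcal X\times\mathcal A\to\mathbb R^d$ ($1\le h\le H$), $\mu_{h+1}:\mathcal X\to\mathbb R^d$ ($1\le h\le H-1$) and reward vectors $\theta_h\in\mathbb R^d$ with $\langle\theta_h,\phi_h(x,a)\rangle\in[0,1]$, such that $\mathbb P_h(x'\mid x,a)=\langle\phi_h(x,a),\mu_{h+1}(x')\rangle$ is a probability distribution in $x'$ for all $x,a$ and $h<H$. It is *$\ell_1$-bounded with bound $C_{\mathrm{nrm}}$* if $\|\phi_h(x,a)\|_\infty\le1$, $\|\theta_h\|_1\le C_{\mathrm{nrm}}$ and $\sum_{x'}\|\mu_{h+1}(x')\|_1\le C_{\mathrm{nrm}}$ throughout. Let $\Pi$ be the set of randomized Markovian policies, $d_h^\pi(x)=\Pr^\pi[x_h=x]$, and $\bar\phi_h(x)=\frac1A\sum_a\phi_h(x,a)$. $M$ is *$\eta$-reachable* if $\max_{\pi\in\Pi} d^\pi_{h+1}(x)\ge\eta\|\mu_{h+1}(x)\|_1$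 for all $x$ and $h<H$. A finite nonempty set $\Psi\subset\Pi$ is an *$\alpha$-approximate policy cover at step $h$* if $\frac1{|\Psi|}\sum_{\pi'\in\Psi}d_h^{\pi'}(x)\ge\alpha\max_{\pi\in\Pi} d_h^\pi(x)$ for all $x$. Vectors $\hat\mu^1,\dots,\hat\mu^m\in\mathbb R^d$ form an *$(\epsilon_{\mathrm{apx}},\epsilon_{\mathrm{neg}},C)$-emulator at step $h$* if (1) $\sum_j\|\hat\mu^j\|_1\le C$; (2) $\langle\mathbb E^\pi[\phi_h(x_h,a_h)],\hat\mu^j\rangle\ge-\epsilon_{\mathrm{neg}}\|\hat\mu^j\|_1$ for all $\pi\in\Pi$ and all $j$; (3) there are states $\tilde x^1,\dots,\tilde x^m$ such that for all $\pi\in\Pi$ $$\Big\|\sum_{x\in\mathcal X}\langle\mathbb E^\pi[\phi_h(x_h,a_h)],\mu_{h+1}(x)\rangle\,\bar\phi_{h+1}(x)-\sum_{j=1}^m\langle\mathbb E^\pi[\phi_h(x_h,a_h)],\hat\mu^j\rangle\,\bar\phi_{h+1}(\tilde x^j)\Big\|_\infty\le\epsilon_{\mathrm{apx}}.$$ **Construction.**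 Given $h$, $\Psi_h$, $\epsilon$, $C_{\mathrm{nrm}}$, $n$, $m$, draw $n+m$ independent episodes, each from $\pi\circ_h\mathrm{Unif}(\mathcal A)$ (follow $\pi$ before step $h$, then act uniformly at random at step $h$) with $\pi\sim\mathrm{Unif}(\Psi_h)$. Keep $(x_h^i,a_h^i,x_{h+1}^i)$, $i\le n$, from the first $n$ and $\tilde x_{h+1}^j$, $j\le m$, from the last $m$. For each $\ell\in[d]$ let $$\hat w_\ell\in\operatorname{argmin}_{\|w\|_1\le C_{\mathrm{nrm}}}\sum_{i=1}^n\big(\langle\phi_h(x_h^i,a_h^i),w\rangle-\bar\phi_{h+1}(x_{h+1}^i)_\ell\big)^2 .$$ The *emulator program* asks for $\hat\mu^1,\dots,\hat\mu^m\in\mathbb R^d$ with $\sum_j\|\hat\mu^j\|_1\le C_{\mathrm{nrm}}$; $\langle\phi_h(x_h^i,a_h^i),\hat\mu^j\rangle\ge0$ for all $i,j$; and, for all $\ell\in[d]$, $$\frac1n\sum_{i=1}^n\Big(\langle\phi_h(x_h^i,a_h^i),\hat w_\ell\rangle-\sum_{j=1}^m\langle\phi_h(x_h^i,a_h^i),\hat\mu^j\rangle\,\bar\phi_{h+1}(\tilde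 x_{h+1}^j)_\ell\Big)^2\le\epsilon^2 .$$ **Lemma.** There is a universal constant $C_0>0$ such that the following holds. Let $M$ be an $\eta$-reachable ($\eta>0$), $\ell_1$-bounded $d$-dimensional linear MDP with bound $C_{\mathrm{nrm}}\ge1$. Let $n,m\in\mathbb N$, $1\le h\le H-1$ and $\epsilon_{\mathrm{neg}},\epsilon_{\mathrm{apx}},\alpha,\delta>0$, and let $\Psi_h$ be an $\alpha$-approximate policy cover at step $h$. Suppose that $$n\ge C_0\max\Big(\frac{C_{\mathrm{nrm}}^2AH^3\log(8AHC_{\mathrm{nrm}}/\epsilon_{\mathrm{neg}})\log(12d/\delta)}{\alpha\,\epsilon_{\mathrm{neg}}^4},\ \frac{C_{\mathrm{nrm}}^4A^2\log(6d/\delta)}{\alpha^2\epsilon_{\mathrm{apx}}^4}\Big),\qquad m\ge C_0\,\frac{A^3\log(12dn/\delta)}{\alpha^3\,\eta\,\epsilon_{\mathrm{apx}}^2}.$$ Consider the emulator program with $\epsilon=\sqrt{\alpha/(4A)}\;\epsilon_{\mathrm{apx}}$. Its solution set is convex, for every realization of the data. With probability at least $1-\delta$ over the $n+m$ episodes, minimizers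 $\hat w_1,\dots,\hat w_d$ exist and, for every choice of them, the program is feasible and each of its solutions is an $(\epsilon_{\mathrm{apx}},\epsilon_{\mathrm{neg}},C_{\mathrm{nrm}})$-emulator at step $h$. In particular, if $\delta<1$, then an $(\epsilon_{\mathrm{apx}},\epsilon_{\mathrm{neg}},C_{\mathrm{nrm}})$-emulator at step $h$ consisting of $m$ vectors exists. -/

import Mathlib

universe u v

noncomputable section

/-- The `ℓ₁` norm on `ℝ^d`.  (Mathlib's norm on `Fin d → ℝ` is the `ℓ_∞` norm.) -/
def l1norm {d : ℕ} (w : Fin d → ℝ) : ℝ := ∑ i, |w i|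

/-- The expectation of a real-valued function under a discrete distribution. -/
def PMF.expect {T : Type*} (p : PMF T) (f : T → ℝ) : ℝ := ∑' t, (p t).toReal * f t

/-- `n` independent samples from a discrete distribution. -/
def PMF.iid {T : Type*} (p : PMF T) : (n : ℕ) → PMF (Fin n → T)
  | 0 => PMF.pure Fin.elim0
  | n + 1 => (PMF.iid p n).bind fun s => p.map fun t => Fin.snoc (α := fun _ => T) s t

/-- A `d`-dimensional linear MDP with state space `X` and action space `A`.  The steps of an episode
are numbered `0, …, H - 1`.  Only `φ h`, `θ h` for `h < H` and `μ h` for `0 < h < H` are meaningful: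
the values at other indices are never used. -/
structure LinearMDP (X : Type u) (A : Type v) (d : ℕ) where
  /-- the horizon -/
  H : ℕ
  /-- the initial state distribution -/
  init : PMF X
  /-- the (known) feature mappings -/
  φ : ℕ → X → A → Fin d → ℝ
  /-- the (unknown) feature mappings -/
  μ : ℕ → X → Fin d → ℝ
  /-- the reward vectors -/
  θ : ℕ → Fin d → ℝ
  reward_mem : ∀ h, h < H → ∀ x a, dotProduct (θ h) (φ h x a) ∈ Set.Icc (0 : ℝ) 1
  trans_nonneg : ∀ h, h + 1 < H → ∀ x a x', 0 ≤ dotProduct (φ h x a) (μ (h + 1) x')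
  trans_hasSum : ∀ h, h + 1 < H → ∀ x a,
    HasSum (fun x' => dotProduct (φ h x a) (μ (h + 1) x')) 1

/-- Randomized Markovian policies: `π h x` is the distribution of the action taken at step `h` in
state `x`.  (Steps `h ≥ H` play no role.) -/
abbrev Policy (X : Type u) (A : Type v) : Type (max u v) := ℕ → X → PMF A

/-- `π ∘_h π'`: follow `π` before step `h`, and `π'` from step `h` on. -/
def Policy.comp {X : Type u} {A : Type v} (π : Policy X A) (h : ℕ) (π' : Policy X A) :
    Policy X A :=
  fun k => if k < h then π k else π' k

/-- The policy that takes a uniformly random action at every step. -/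
def Policy.unif (X : Type u) (A : Type v) [Fintype A] [Nonempty A] : Policy X A :=
  fun _ _ => PMF.uniformOfFintype A

namespace LinearMDP

variable {X : Type u} {A : Type v} {d : ℕ}

/-- The transition distribution `ℙ_h(x, a)` on next states, with density
`x' ↦ ⟨φ_h(x,a), μ_{h+1}(x')⟩`, for `h + 1 < H`.  (For other `h` a dummy value, never used.) -/
def trans (M : LinearMDP X A d) (h : ℕ) (x : X) (a : A) : PMF X :=
  if hh : h + 1 < M.H then
    ⟨fun x' => ENNReal.ofReal (dotProduct (M.φ h x a) (M.μ (h + 1) x')), by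
      have h1 := M.trans_hasSum h hh x a
      have h2 := ENNReal.ofReal_tsum_of_nonneg (M.trans_nonneg h hh x a) h1.summable
      rw [h1.tsum_eq, ENNReal.ofReal_one] at h2
      exact h2 ▸ ENNReal.summable.hasSum⟩
  else PMF.pure x

/-- The law of the trajectory `(x_0, a_0), …, (x_k, a_k)` generated by policy `π`. -/
def traj (M : LinearMDP X A d) (π : Policy X A) : (k : ℕ) → PMF (Fin (k + 1) → X × A)
  | 0 => M.init.bind fun x => (π 0 x).map fun a _ => (x, a)
  | k + 1 => (M.traj π k).bind fun τ =>
      (M.trans k (τ (Fin.last k)).1 (τ (Fin.last k)).2).bind fun x' =>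
        (π (k + 1) x').map fun a' => Fin.snoc (α := fun _ => X × A) τ (x', a')

/-- The state visitation density `d_h^π(x) = Pr^π[x_h = x]`. -/
def visit (M : LinearMDP X A d) (π : Policy X A) (h : ℕ) (x : X) : ℝ :=
  ((M.traj π h).map (fun τ => (τ (Fin.last h)).1) x).toReal

/-- The expected feature vector `𝔼^π[φ_h(x_h, a_h)]`. -/
def meanφ (M : LinearMDP X A d) (π : Policy X A) (h : ℕ) : Fin d → ℝ :=
  fun l => (M.traj π h).expect fun τ => M.φ h (τ (Fin.last h)).1 (τ (Fin.last h)).2 l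

/-- The average feature vector of a state at step `h`. -/
def φavg [Fintype A] (M : LinearMDP X A d) (h : ℕ) (x : X) : Fin d → ℝ :=
  fun l => (1 / (Fintype.card A : ℝ)) * ∑ a, M.φ h x a l

/-- `M` is an `ℓ₁`-bounded linear MDP with bound `C`.  (`‖·‖` is the `ℓ_∞` norm.) -/
structure L1Bounded (M : LinearMDP X A d) (C : ℝ) : Prop where
  φ_le : ∀ h, h < M.H → ∀ x a, ‖M.φ h x a‖ ≤ 1
  θ_le : ∀ h, h < M.H → l1norm (M.θ h) ≤ C
  μ_summable : ∀ h, h + 1 < M.H → Summable fun x' => l1norm (M.μ (h + 1) x')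
  μ_le : ∀ h, h + 1 < M.H → ∑' x', l1norm (M.μ (h + 1) x') ≤ C

/-- `M` is `η`-reachable: `max_π d_{h+1}^π(x) ≥ η ‖μ_{h+1}(x)‖₁` for all `h` and `x`. -/
def Reachable (M : LinearMDP X A d) (η : ℝ) : Prop :=
  ∀ h, h + 1 < M.H → ∀ x, ∃ π : Policy X A, η * l1norm (M.μ (h + 1) x) ≤ M.visit π (h + 1) x

/-- `Ψ` is an `α`-approximate policy cover at step `h`: for all `x`,
`(1/|Ψ|) ∑_{π' ∈ Ψ} d_h^{π'}(x) ≥ α max_π d_h^π(x)`. -/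
def PolicyCover (M : LinearMDP X A d) (α : ℝ) (h : ℕ) (Ψ : Finset (Policy X A)) : Prop :=
  ∀ x, ∀ π : Policy X A,
    α * M.visit π h x ≤ (1 / (Ψ.card : ℝ)) * ∑ π' ∈ Ψ, M.visit π' h x

/-- The vectors `μhat j` form an `(εapx, εneg, C)`-emulator of `M` at step `h`. -/
structure IsEmulator [Fintype A] (M : LinearMDP X A d) (h : ℕ) (εapx εneg C : ℝ) {m : ℕ}
    (μhat : Fin m → Fin d → ℝ) : Prop where
  norm_le : ∑ j, l1norm (μhat j) ≤ C
  apx_nonneg : ∀ (π : Policy X A) (j : Fin m),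
    -(εneg * l1norm (μhat j)) ≤ dotProduct (M.meanφ π h) (μhat j)
  apx : ∃ xt : Fin m → X, ∀ π : Policy X A,
    ‖fun l : Fin d =>
        ∑' x, dotProduct (M.meanφ π h) (M.μ (h + 1) x) * M.φavg (h + 1) x l
          - ∑ j, dotProduct (M.meanφ π h) (μhat j) * M.φavg (h + 1) (xt j) l‖ ≤ εapx

/-- The law of one sample `(x_h, a_h, x_{h+1})`, where the trajectory is generated by
`π ∘_h unif(A)` for a policy `π` drawn uniformly from `Ψ`. -/
def sampleLaw [Fintype A] [Nonempty A] (M : LinearMDP X A d) (h : ℕ) (Ψ : Finset (Policy X A))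
    (hΨ : Ψ.Nonempty) : PMF (X × A × X) :=
  (PMF.uniformOfFinset Ψ hΨ).bind fun π =>
    (M.traj (π.comp h (Policy.unif X A)) (h + 1)).map fun τ =>
      ((τ (Fin.last h).castSucc).1, (τ (Fin.last h).castSucc).2, (τ (Fin.last (h + 1))).1)

/-- The law of the two independent datasets: `n` i.i.d. transitions `(x_h^i, a_h^i, x_{h+1}^i)` and
`m` i.i.d. states `x̃_{h+1}^j`, from `n + m` independent episodes. -/
def drawData [Fintype A] [Nonempty A] (M : LinearMDP X A d) (h : ℕ) (Ψ : Finset (Policy X A))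
    (hΨ : Ψ.Nonempty) (n m : ℕ) : PMF ((Fin n → X × A × X) × (Fin m → X)) :=
  ((M.sampleLaw h Ψ hΨ).iid n).bind fun c =>
    (((M.sampleLaw h Ψ hΨ).map fun s => s.2.2).iid m).map fun t => (c, t)

/-- `what l` (for every coordinate `l`) is a solution of the `ℓ₁`-constrained regression
`argmin_{‖w‖₁ ≤ C} ∑_i (⟨φ_h(x_h^i, a_h^i), w⟩ - φavg_{h+1}(x_{h+1}^i)_l)²`. -/
def IsRegressor [Fintype A] (M : LinearMDP X A d) (h : ℕ) (C : ℝ) {n : ℕ}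
    (c : Fin n → X × A × X) (what : Fin d → Fin d → ℝ) : Prop :=
  ∀ l, l1norm (what l) ≤ C ∧ ∀ w : Fin d → ℝ, l1norm w ≤ C →
    ∑ i, (dotProduct (M.φ h (c i).1 (c i).2.1) (what l) - M.φavg (h + 1) (c i).2.2 l) ^ 2 ≤
      ∑ i, (dotProduct (M.φ h (c i).1 (c i).2.1) w - M.φavg (h + 1) (c i).2.2 l) ^ 2

/-- `μhat` satisfies the constraints of the emulator program with tolerance `ε`, for the
transition dataset `c`, the state dataset `t` and the regressors `what`. -/
structure Feasible [Fintype A] (M : LinearMDP X A d) (h : ℕ) (ε C : ℝ) {n m : ℕ}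
    (c : Fin n → X × A × X) (t : Fin m → X) (what : Fin d → Fin d → ℝ)
    (μhat : Fin m → Fin d → ℝ) : Prop where
  norm_le : ∑ j, l1norm (μhat j) ≤ C
  nonneg : ∀ i j, 0 ≤ dotProduct (M.φ h (c i).1 (c i).2.1) (μhat j)
  fit : ∀ l, (1 / (n : ℝ)) * ∑ i,
    (dotProduct (M.φ h (c i).1 (c i).2.1) (what l)
      - ∑ j, dotProduct (M.φ h (c i).1 (c i).2.1) (μhat j) * M.φavg (h + 1) (t j) l) ^ 2 ≤ ε ^ 2

end LinearMDP

end

/-! Two statements are needed: some point satisfies the program, and, on a good event for the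
transition data, every feasible point is an emulator.

Feasibility. Let p be the law of the sampled successor states. Reachability and the policy cover
give ‖μ_{h+1}(x)‖₁ ≤ B p(x) with B = A/(αη), so the importance weighted vectors μ_{h+1}(x̃^j)/(m
p(x̃^j)) have bounded weights. They are nonnegative on all features, and by Bernstein they reproduce
the conditional mean of φ̄_{h+1} at every sampled pair. Shrinking them by a factor 1 + ε/4 restores
the exact norm bound at small cost in accuracy (`iid_exists_emulator`). That conditional mean is
linear in φ_h, with coefficient vector `target`, and least squares recovers it in sample
(`IsRegressor.sum_sq_le`), so the fit constraint holds.

Accuracy. In each coordinate the emulator error is a single linear functional of φ_h with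
coefficient norm at most 2C. The fit constraint makes its empirical second moment small, entrywise
concentration of the Gram matrix transfers this to the sampling law, and the cover transfers it to
every policy at the price A/α. The tolerance ε² = αζ²/(4A) is calibrated to that price, where ζ is
the required accuracy.

Approximate nonnegativity. This is a one-sided margin bound (`margin_bound`): a functional u with
‖u‖₁ = 1 that is nonnegative on the sample is rarely below -ε/2, where ε now stands for the
negativity tolerance. By Maurey's argument u is close to an average of k random signed basis
vectors, so a union bound over (2d)^k sparse vectors replaces uniformity over u. It is run under a
thinned sampling law, weighted by α max_π d^π/(actual coverage) ≤ 1. This law still dominates every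
policy at price A/α but has mass at most αC, because Σ_x max_π d^π(x) ≤ C; hence α cancels in the
choice of k and no log(1/α) appears. -/

/-- A real-valued function with bounded absolute value. -/
def IsBddFun {T : Type*} (f : T → ℝ) : Prop := ∃ K, ∀ t, |f t| ≤ K

/-! ### Closure properties of bounded functions -/

namespace IsBddFun

variable {T S : Type*} {f g : T → ℝ}

theorem const (c : ℝ) : IsBddFun fun _ : T => c := ⟨|c|, fun _ => le_rfl⟩

theorem add (hf : IsBddFun f) (hg : IsBddFun g) : IsBddFun fun t => f t + g t := by
  obtain ⟨K, hK⟩ := hf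
  obtain ⟨L, hL⟩ := hg
  exact ⟨K + L, fun t => (abs_add_le _ _).trans (add_le_add (hK t) (hL t))⟩

theorem mul (hf : IsBddFun f) (hg : IsBddFun g) : IsBddFun fun t => f t * g t := by
  obtain ⟨K, hK⟩ := hf
  obtain ⟨L, hL⟩ := hg
  refine ⟨K * L, fun t => ?_⟩
  rw [abs_mul]
  exact mul_le_mul (hK t) (hL t) (abs_nonneg _) ((abs_nonneg _).trans (hK t))

theorem neg (hf : IsBddFun f) : IsBddFun fun t => - f t := by
  obtain ⟨K, hK⟩ := hf
  exact ⟨K, fun t => by rw [abs_neg]; exact hK t⟩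

theorem sub (hf : IsBddFun f) (hg : IsBddFun g) : IsBddFun fun t => f t - g t := by
  simpa only [sub_eq_add_neg] using hf.add hg.neg

theorem const_mul (c : ℝ) (hf : IsBddFun f) : IsBddFun fun t => c * f t := (const c).mul hf

theorem sq (hf : IsBddFun f) : IsBddFun fun t => f t ^ 2 := by
  simpa only [pow_two] using hf.mul hf

theorem exp (hf : IsBddFun f) : IsBddFun fun t => Real.exp (f t) := by
  obtain ⟨K, hK⟩ := hf
  refine ⟨Real.exp K, fun t => ?_⟩
  rw [abs_of_pos (Real.exp_pos _)]
  exact Real.exp_le_exp.2 ((le_abs_self _).trans (hK t))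

theorem sum {ι : Type*} (s : Finset ι) {F : ι → T → ℝ} (h : ∀ i ∈ s, IsBddFun (F i)) :
    IsBddFun fun t => ∑ i ∈ s, F i t := by
  classical
  induction s using Finset.induction_on with
  | empty => simpa using const (T := T) 0
  | insert a s ha ih =>
    simp only [Finset.sum_insert ha]
    exact (h a (by simp)).add (ih fun i hi => h i (by simp [hi]))

theorem comp (hf : IsBddFun f) (k : S → T) : IsBddFun fun s => f (k s) := by
  obtain ⟨K, hK⟩ := hf
  exact ⟨K, fun s => hK _⟩

end IsBddFun

/-! ### Expectations and concentration for discrete distributions -/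

namespace PMF

variable {T S : Type*}

theorem tsum_toReal (p : PMF T) : ∑' t, (p t).toReal = 1 := by
  rw [← ENNReal.tsum_toReal_eq (fun t => p.apply_ne_top t), p.tsum_coe, ENNReal.toReal_one]

theorem summable_toReal (p : PMF T) : Summable fun t => (p t).toReal :=
  ENNReal.summable_toReal (by rw [p.tsum_coe]; exact ENNReal.one_ne_top)

theorem summable_mul (p : PMF T) {f : T → ℝ} (hf : IsBddFun f) :
    Summable fun t => (p t).toReal * f t := by
  obtain ⟨K, hK⟩ := hf
  refine Summable.of_norm_bounded (p.summable_toReal.mul_right K) fun t => ?_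
  rw [Real.norm_eq_abs, abs_mul, abs_of_nonneg ENNReal.toReal_nonneg]
  exact mul_le_mul_of_nonneg_left (hK t) ENNReal.toReal_nonneg

theorem expect_const (p : PMF T) (c : ℝ) : p.expect (fun _ => c) = c := by
  rw [expect, tsum_mul_right, p.tsum_toReal, one_mul]

theorem expect_add (p : PMF T) {f g : T → ℝ} (hf : IsBddFun f) (hg : IsBddFun g) :
    p.expect (fun t => f t + g t) = p.expect f + p.expect g := by
  simp only [expect, mul_add]
  exact (p.summable_mul hf).tsum_add (p.summable_mul hg)

theorem expect_const_mul (p : PMF T) (c : ℝ) (f : T → ℝ) :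
    p.expect (fun t => c * f t) = c * p.expect f := by
  simp only [expect, mul_left_comm _ c, tsum_mul_left]

theorem expect_neg (p : PMF T) (f : T → ℝ) : p.expect (fun t => - f t) = - p.expect f := by
  simpa using p.expect_const_mul (-1) f

theorem expect_sub (p : PMF T) {f g : T → ℝ} (hf : IsBddFun f) (hg : IsBddFun g) :
    p.expect (fun t => f t - g t) = p.expect f - p.expect g := by
  simp only [sub_eq_add_neg]
  rw [p.expect_add hf hg.neg, p.expect_neg]

theorem expect_mono (p : PMF T) {f g : T → ℝ} (hf : IsBddFun f) (hg : IsBddFun g)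
    (h : ∀ t, f t ≤ g t) : p.expect f ≤ p.expect g :=
  (p.summable_mul hf).tsum_le_tsum
    (fun t => mul_le_mul_of_nonneg_left (h t) ENNReal.toReal_nonneg) (p.summable_mul hg)

theorem expect_nonneg (p : PMF T) {f : T → ℝ} (h : ∀ t, 0 ≤ f t) : 0 ≤ p.expect f :=
  tsum_nonneg fun t => mul_nonneg ENNReal.toReal_nonneg (h t)

theorem expect_finset_sum (p : PMF T) {ι : Type*} (s : Finset ι) {F : ι → T → ℝ}
    (h : ∀ i ∈ s, IsBddFun (F i)) :
    p.expect (fun t => ∑ i ∈ s, F i t) = ∑ i ∈ s, p.expect (F i) := by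
  simp only [expect, Finset.mul_sum]
  exact Summable.tsum_finsetSum fun i hi => p.summable_mul (h i hi)

theorem abs_expect_le (p : PMF T) {f : T → ℝ} {K : ℝ} (h : ∀ t, |f t| ≤ K) :
    |p.expect f| ≤ K := by
  have hf : IsBddFun f := ⟨K, h⟩
  rw [abs_le]
  constructor
  · rw [← p.expect_const (-K)]
    exact p.expect_mono (.const _) hf fun t => (abs_le.1 (h t)).1
  · rw [← p.expect_const K]
    exact p.expect_mono hf (.const _) fun t => (abs_le.1 (h t)).2

/-- Fubini: a bounded f keeps the double series dominated by a multiple of the joint law, which is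
summable. -/
theorem expect_bind (p : PMF T) (g : T → PMF S) {f : S → ℝ} (hf : IsBddFun f) :
    (p.bind g).expect f = p.expect fun t => (g t).expect f := by
  have hsum : Summable fun q : S × T => (p q.2).toReal * ((g q.2 q.1).toReal * f q.1) := by
    obtain ⟨K, hK⟩ := hf
    have h1 : ∑' q : S × T, p q.2 * g q.2 q.1 ≠ ⊤ := by
      rw [ENNReal.tsum_prod (f := fun s t => p t * g t s), ENNReal.tsum_comm]
      simp [ENNReal.tsum_mul_left, PMF.tsum_coe]
    refine Summable.of_norm_bounded ((ENNReal.summable_toReal h1).mul_right K) fun q => ?_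
    rw [ENNReal.toReal_mul, mul_assoc, norm_mul, norm_mul, Real.norm_of_nonneg
      ENNReal.toReal_nonneg, Real.norm_of_nonneg ENNReal.toReal_nonneg, Real.norm_eq_abs]
    gcongr
    exact hK _
  have h2 : ∀ s, ((p.bind g) s).toReal * f s
      = ∑' t, (p t).toReal * ((g t s).toReal * f s) := by
    intro s
    rw [PMF.bind_apply, ENNReal.tsum_toReal_eq
      (fun t => ENNReal.mul_ne_top (p.apply_ne_top _) ((g t).apply_ne_top _)), ← tsum_mul_right]
    simp only [ENNReal.toReal_mul, mul_assoc]
  simp only [expect, h2]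
  rw [← Summable.tsum_comm (f := fun s t => (p t).toReal * ((g t s).toReal * f s)) hsum]
  simp only [tsum_mul_left]

theorem expect_pure (t : T) (f : T → ℝ) : (PMF.pure t).expect f = f t := by
  classical
  rw [expect, tsum_eq_single t]
  · simp
  · intro s hs
    simp [PMF.pure_apply, hs]

theorem expect_map (p : PMF T) (k : T → S) {f : S → ℝ} (hf : IsBddFun f) :
    (p.map k).expect f = p.expect fun t => f (k t) := by
  rw [← PMF.bind_pure_comp, p.expect_bind _ hf]
  simp only [Function.comp, expect_pure]

theorem expect_uniformOfFintype [Fintype T] [Nonempty T] (f : T → ℝ) :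
    (PMF.uniformOfFintype T).expect f = (1 / (Fintype.card T : ℝ)) * ∑ t, f t := by
  rw [expect, tsum_fintype, Finset.mul_sum]
  refine Finset.sum_congr rfl fun t _ => ?_
  simp

theorem ofReal_expect (p : PMF T) {f : T → ℝ} (hf : IsBddFun f) (h : ∀ t, 0 ≤ f t) :
    ENNReal.ofReal (p.expect f) = ∑' t, p t * ENNReal.ofReal (f t) := by
  rw [expect, ENNReal.ofReal_tsum_of_nonneg
    (fun t => mul_nonneg ENNReal.toReal_nonneg (h t)) (p.summable_mul hf)]
  refine tsum_congr fun t => ?_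
  rw [ENNReal.ofReal_mul ENNReal.toReal_nonneg, ENNReal.ofReal_toReal (p.apply_ne_top t)]

theorem tsum_bind_mul (p : PMF T) (g : T → PMF S) (F : S → ENNReal) :
    ∑' s, (p.bind g) s * F s = ∑' t, p t * ∑' s, g t s * F s := by
  simp only [PMF.bind_apply, ← ENNReal.tsum_mul_right, ← ENNReal.tsum_mul_left]
  rw [ENNReal.tsum_comm]
  simp only [mul_assoc]

theorem tsum_map_mul (p : PMF T) (k : T → S) (F : S → ENNReal) :
    ∑' s, (p.map k) s * F s = ∑' t, p t * F (k t) := by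
  classical
  rw [← PMF.bind_pure_comp, tsum_bind_mul]
  refine tsum_congr fun t => ?_
  congr 1
  rw [tsum_eq_single (k t)]
  · simp
  · intro s hs
    simp [PMF.pure_apply, hs]

/-- Independence in the form needed for moment generating functions; with `ENNReal` values no
summability has to be checked. -/
theorem tsum_iid_mul_prod (p : PMF T) (F : T → ENNReal) (n : ℕ) :
    ∑' s, (p.iid n) s * ∏ i, F (s i) = (∑' t, p t * F t) ^ n := by
  induction n with
  | zero =>
    simp only [iid, Finset.univ_eq_empty, Finset.prod_empty, mul_one, pow_zero]
    exact PMF.tsum_coe _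
  | succ n ih =>
    simp only [iid, tsum_bind_mul, tsum_map_mul, Fin.prod_univ_castSucc, Fin.snoc_castSucc,
      Fin.snoc_last]
    rw [pow_succ, ← ih, ← ENNReal.tsum_mul_right]
    refine tsum_congr fun s => ?_
    simp only [mul_left_comm _ (∏ i, F (s i)), ENNReal.tsum_mul_left]
    ring

theorem toOuterMeasure_le_tsum (p : PMF T) (E : Set T) (F : T → ENNReal)
    (h : ∀ t ∈ E, 1 ≤ F t) : p.toOuterMeasure E ≤ ∑' t, p t * F t := by
  rw [PMF.toOuterMeasure_apply]
  refine ENNReal.tsum_le_tsum fun t => ?_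
  by_cases ht : t ∈ E
  · rw [Set.indicator_of_mem ht]
    exact le_mul_of_one_le_right' (h t ht)
  · rw [Set.indicator_of_notMem ht]
    exact zero_le

/-- Chernoff's bound for independent samples. -/
theorem iid_chernoff (p : PMF T) {f : T → ℝ} (hf : IsBddFun f) {c : ℝ}
    (hc : p.expect (fun t => Real.exp (f t)) ≤ Real.exp c) (n : ℕ) (a : ℝ) :
    (p.iid n).toOuterMeasure {s | a ≤ ∑ i, f (s i)} ≤ ENNReal.ofReal (Real.exp (n * c - a)) := by
  have h1 := (p.iid n).toOuterMeasure_le_tsum {s | a ≤ ∑ i, f (s i)}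
    (fun s => ENNReal.ofReal (Real.exp (-a)) * ∏ i, ENNReal.ofReal (Real.exp (f (s i)))) (by
      intro s hs
      rw [← ENNReal.ofReal_prod_of_nonneg (fun i _ => (Real.exp_pos _).le),
        ← ENNReal.ofReal_mul (Real.exp_pos _).le, ← Real.exp_sum, ← Real.exp_add,
        ENNReal.one_le_ofReal]
      apply Real.one_le_exp
      have : a ≤ ∑ i, f (s i) := hs
      linarith)
  refine h1.trans ?_
  simp only [mul_left_comm _ (ENNReal.ofReal (Real.exp (-a))), ENNReal.tsum_mul_left]
  rw [p.tsum_iid_mul_prod (fun t => ENNReal.ofReal (Real.exp (f t))),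
    ← p.ofReal_expect hf.exp (fun t => (Real.exp_pos _).le),
    ← ENNReal.ofReal_pow (p.expect_nonneg fun t => (Real.exp_pos _).le),
    ← ENNReal.ofReal_mul (Real.exp_pos _).le]
  refine ENNReal.ofReal_le_ofReal ?_
  calc Real.exp (-a) * p.expect (fun t => Real.exp (f t)) ^ n
      ≤ Real.exp (-a) * Real.exp c ^ n := by
        gcongr
        exact p.expect_nonneg fun t => (Real.exp_pos _).le
    _ = Real.exp (n * c - a) := by
        rw [← Real.exp_nat_mul, ← Real.exp_add]
        congr 1
        ring

/-- By convexity the exponential lies below its chord over [-a, a]; a * y divides this interval with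
weights (1 ± y)/2. -/
theorem exp_mul_le_cosh_add {y : ℝ} (hy : |y| ≤ 1) (a : ℝ) :
    Real.exp (a * y) ≤ Real.cosh a + y * Real.sinh a := by
  obtain ⟨h1, h2⟩ := abs_le.1 hy
  have h := convexOn_exp.2 (Set.mem_univ a) (Set.mem_univ (-a))
    (show 0 ≤ (1 + y) / 2 by linarith) (show 0 ≤ (1 - y) / 2 by linarith) (by ring)
  simp only [smul_eq_mul] at h
  rw [Real.cosh_eq, Real.sinh_eq]
  have e : (1 + y) / 2 * a + (1 - y) / 2 * -a = a * y := by ring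
  rw [e] at h
  linarith

/-- Hoeffding's lemma. -/
theorem expect_exp_le_of_expect_eq_zero (p : PMF T) {f : T → ℝ} {b : ℝ} (hb : 0 < b)
    (hf : ∀ t, |f t| ≤ b) (h0 : p.expect f = 0) (r : ℝ) :
    p.expect (fun t => Real.exp (r * f t)) ≤ Real.exp (r ^ 2 * b ^ 2 / 2) := by
  have hB : IsBddFun f := ⟨b, hf⟩
  have h1 : ∀ t, Real.exp (r * f t) ≤ Real.cosh (r * b) + (Real.sinh (r * b) / b) * f t := by
    intro t
    have := exp_mul_le_cosh_add (y := f t / b)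
      (by rw [abs_div, abs_of_pos hb, div_le_one hb]; exact hf t) (r * b)
    have e1 : r * b * (f t / b) = r * f t := by field_simp
    rw [e1] at this
    calc _ ≤ _ := this
      _ = _ := by ring
  calc p.expect (fun t => Real.exp (r * f t))
      ≤ p.expect (fun t => Real.cosh (r * b) + (Real.sinh (r * b) / b) * f t) :=
        p.expect_mono (hB.const_mul r).exp ((IsBddFun.const _).add (hB.const_mul _)) h1
    _ = Real.cosh (r * b) := by
        rw [p.expect_add (.const _) (hB.const_mul _), p.expect_const, p.expect_const_mul, h0]
        ring
    _ ≤ Real.exp (r ^ 2 * b ^ 2 / 2) := by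
        have := Real.cosh_le_exp_half_sq (r * b)
        rwa [mul_pow] at this

/-- Hoeffding's inequality. -/
theorem iid_hoeffding (p : PMF T) {f : T → ℝ} {b : ℝ} (hb : 0 < b)
    (hf : ∀ t, |f t| ≤ b) (h0 : p.expect f = 0) (n : ℕ) {r : ℝ} (hr : 0 < r) :
    (p.iid n).toOuterMeasure {s | n * r ≤ ∑ i, f (s i)}
      ≤ ENNReal.ofReal (Real.exp (-(n * r ^ 2 / (2 * b ^ 2)))) := by
  have hB : IsBddFun f := ⟨b, hf⟩
  have h := p.iid_chernoff (hB.const_mul (r / b ^ 2))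
    (p.expect_exp_le_of_expect_eq_zero hb hf h0 (r / b ^ 2)) n (r / b ^ 2 * (n * r))
  have e : {s : Fin n → T | r / b ^ 2 * (n * r) ≤ ∑ i, r / b ^ 2 * f (s i)}
      = {s | n * r ≤ ∑ i, f (s i)} := by
    ext s
    simp only [Set.mem_ofPred_eq, ← Finset.mul_sum]
    exact mul_le_mul_iff_right₀ (by positivity)
  rw [e] at h
  refine h.trans (le_of_eq ?_)
  congr 2
  field_simp
  ring

/-- Bernstein's inequality, with a free parameter. -/
theorem iid_bernstein (p : PMF T) {f : T → ℝ} {b K V q : ℝ} (hf : ∀ t, |f t| ≤ b)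
    (hK : p.expect f ≤ K) (hV : p.expect (fun t => f t ^ 2) ≤ V) (hq : 0 < q) (hqb : q * b ≤ 1)
    (n : ℕ) (r : ℝ) :
    (p.iid n).toOuterMeasure {s | n * (K + r) ≤ ∑ i, f (s i)}
      ≤ ENNReal.ofReal (Real.exp (-(n * (q * r - q ^ 2 * V)))) := by
  have hB : IsBddFun f := ⟨b, hf⟩
  have hm : p.expect (fun t => Real.exp (q * f t)) ≤ Real.exp (q * K + q ^ 2 * V) := by
    -- The inequality exp x ≤ 1 + x + x² is valid for |x| ≤ 1, which is what q * b ≤ 1 ensures. No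
    -- centring is needed: V bounds the raw second moment.
    have h1 : ∀ t, Real.exp (q * f t) ≤ 1 + (q * f t + q ^ 2 * f t ^ 2) := by
      intro t
      have hle : |q * f t| ≤ 1 := by
        rw [abs_mul, abs_of_pos hq]
        exact (mul_le_mul_of_nonneg_left (hf t) hq.le).trans hqb
      have := (abs_le.1 (Real.abs_exp_sub_one_sub_id_le hle)).2
      nlinarith
    calc p.expect (fun t => Real.exp (q * f t))
        ≤ p.expect (fun t => 1 + (q * f t + q ^ 2 * f t ^ 2)) :=
          p.expect_mono (hB.const_mul q).exp
            ((IsBddFun.const _).add ((hB.const_mul q).add (hB.sq.const_mul _))) h1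
      _ = 1 + (q * p.expect f + q ^ 2 * p.expect (fun t => f t ^ 2)) := by
          rw [p.expect_add (.const _) ((hB.const_mul q).add (hB.sq.const_mul _)), p.expect_const,
            p.expect_add (hB.const_mul q) (hB.sq.const_mul _), p.expect_const_mul,
            p.expect_const_mul]
      _ ≤ 1 + (q * K + q ^ 2 * V) := by gcongr
      _ ≤ Real.exp (q * K + q ^ 2 * V) := by
          rw [add_comm]
          exact Real.add_one_le_exp _
  have h := p.iid_chernoff (hB.const_mul q) hm n (q * (n * (K + r)))
  have e : {s : Fin n → T | q * (n * (K + r)) ≤ ∑ i, q * f (s i)}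
      = {s | n * (K + r) ≤ ∑ i, f (s i)} := by
    ext s
    simp only [Set.mem_ofPred_eq, ← Finset.mul_sum]
    exact mul_le_mul_iff_right₀ hq
  rw [e] at h
  refine h.trans (le_of_eq ?_)
  congr 2
  ring

/-- Multiplicative Chernoff bound, upper tail. -/
theorem iid_upper_tail (p : PMF T) {f : T → ℝ} (hf0 : ∀ t, 0 ≤ f t) (hf1 : ∀ t, f t ≤ 1)
    {K : ℝ} (hK : p.expect f ≤ K) (n : ℕ) :
    (p.iid n).toOuterMeasure {s | 3 * n * K ≤ ∑ i, f (s i)}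
      ≤ ENNReal.ofReal (Real.exp (-(n * K))) := by
  have hf : ∀ t, |f t| ≤ 1 := fun t => by rw [abs_of_nonneg (hf0 t)]; exact hf1 t
  have hB : IsBddFun f := ⟨1, hf⟩
  have hsq : p.expect (fun t => f t ^ 2) ≤ K :=
    (p.expect_mono hB.sq hB fun t => by nlinarith [hf0 t, hf1 t]).trans hK
  -- Since f² ≤ f, K also bounds the second moment; q = 1 and r = 2K leave the exponent n(2K - K).
  have h := p.iid_bernstein hf hK hsq one_pos (by norm_num) n (2 * K)
  refine (le_of_eq ?_).trans (h.trans (le_of_eq ?_))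
  · congr 2; ext s; rw [show 3 * (n : ℝ) * K = n * (K + 2 * K) by ring]
  · congr 2; ring

/-- Multiplicative Chernoff bound, lower tail. -/
theorem iid_lower_tail (p : PMF T) {f : T → ℝ} (hf0 : ∀ t, 0 ≤ f t) (hf1 : ∀ t, f t ≤ 1)
    {K : ℝ} (hK : K ≤ p.expect f) (n : ℕ) :
    (p.iid n).toOuterMeasure {s | ∑ i, f (s i) ≤ n * K / 4}
      ≤ ENNReal.ofReal (Real.exp (-(n * K / 4))) := by
  have hf : ∀ t, |f t| ≤ 1 := fun t => by rw [abs_of_nonneg (hf0 t)]; exact hf1 t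
  have hB : IsBddFun f := ⟨1, hf⟩
  have hm : p.expect (fun t => Real.exp (- f t)) ≤ Real.exp (-K / 2) := by
    -- Chord of the exponential over [-1, 0], with exp(-1) ≤ 1/2.
    have h1 : ∀ t, Real.exp (- f t) ≤ 1 + (-1 / 2) * f t := by
      intro t
      have h := convexOn_exp.2 (Set.mem_univ (-1)) (Set.mem_univ 0) (hf0 t)
        (show 0 ≤ 1 - f t by linarith [hf1 t]) (by ring)
      simp only [smul_eq_mul, mul_zero, add_zero, Real.exp_zero, mul_one, mul_neg] at h
      have h2 : Real.exp (-1) ≤ 1 / 2 := by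
        rw [Real.exp_neg, ← one_div]
        have := Real.add_one_le_exp (1 : ℝ)
        exact one_div_le_one_div_of_le (by norm_num) (by linarith)
      nlinarith [hf0 t]
    calc p.expect (fun t => Real.exp (- f t))
        ≤ p.expect (fun t => 1 + (-1 / 2) * f t) :=
          p.expect_mono hB.neg.exp ((IsBddFun.const _).add (hB.const_mul _)) h1
      _ = 1 + (-1 / 2) * p.expect f := by
          rw [p.expect_add (.const _) (hB.const_mul _), p.expect_const, p.expect_const_mul]
      _ ≤ -K / 2 + 1 := by linarith
      _ ≤ Real.exp (-K / 2) := Real.add_one_le_exp _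
  have h := p.iid_chernoff hB.neg hm n (-(n * K / 4))
  refine (le_of_eq ?_).trans (h.trans (le_of_eq ?_))
  · congr 2; ext s; rw [Finset.sum_neg_distrib, neg_le_neg_iff]
  · congr 2; ring

/-- Subadditivity of the outer measure suffices, so the event need not be measurable. -/
theorem one_sub_le_toOuterMeasure (p : PMF T) (E : Set T) {δ : ℝ} (hδ : 0 ≤ δ)
    (h : p.toOuterMeasure Eᶜ ≤ ENNReal.ofReal δ) :
    ENNReal.ofReal (1 - δ) ≤ p.toOuterMeasure E := by
  have h1 : (1 : ENNReal) ≤ p.toOuterMeasure E + p.toOuterMeasure Eᶜ := by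
    have h2 : p.toOuterMeasure Set.univ = 1 := by
      rw [PMF.toOuterMeasure_apply]
      simp [PMF.tsum_coe]
    rw [← h2, ← Set.union_compl_self E]
    exact MeasureTheory.measure_union_le _ _
  rw [ENNReal.ofReal_sub _ hδ, ENNReal.ofReal_one, tsub_le_iff_right]
  exact h1.trans (add_le_add_right h _)

end PMF

/-! ### State and action marginals, and the total visitation mass -/

namespace LinearMDP

variable {X : Type u} {A : Type v} {d : ℕ}

/-- The law of the state at step `h`. -/
noncomputable def stateLaw (M : LinearMDP X A d) (π : Policy X A) (h : ℕ) : PMF X :=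
  (M.traj π h).map fun τ => (τ (Fin.last h)).1

/-- The law of the state-action pair at step `h`. -/
noncomputable def saLaw (M : LinearMDP X A d) (π : Policy X A) (h : ℕ) : PMF (X × A) :=
  (M.traj π h).map fun τ => τ (Fin.last h)

theorem visit_eq (M : LinearMDP X A d) (π : Policy X A) (h : ℕ) (x : X) :
    M.visit π h x = (M.stateLaw π h x).toReal := rfl

theorem stateLaw_zero (M : LinearMDP X A d) (π : Policy X A) : M.stateLaw π 0 = M.init := by
  simp only [stateLaw, traj, PMF.map_bind, PMF.map_comp]
  conv_rhs => rw [← PMF.bind_pure M.init]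
  congr 1
  funext x
  exact PMF.map_const _ _

theorem stateLaw_succ (M : LinearMDP X A d) (π : Policy X A) (k : ℕ) :
    M.stateLaw π (k + 1) = (M.saLaw π k).bind fun s => M.trans k s.1 s.2 := by
  simp only [stateLaw, saLaw, traj, PMF.map_bind, PMF.map_comp, PMF.bind_map]
  congr 1
  funext τ
  simp only [Function.comp_def, Fin.snoc_last]
  conv_rhs => rw [← PMF.bind_pure (M.trans k _ _)]
  congr 1
  funext x
  exact PMF.map_const _ _

/-- The Markov property of policies: the current action depends on the past only through the current
state. -/
theorem saLaw_eq (M : LinearMDP X A d) (π : Policy X A) (k : ℕ) :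
    M.saLaw π k = (M.stateLaw π k).bind fun x => (π k x).map fun a => (x, a) := by
  cases k with
  | zero =>
    rw [stateLaw_zero]
    simp only [saLaw, traj, PMF.map_bind, PMF.map_comp]
    rfl
  | succ k =>
    rw [stateLaw_succ]
    simp only [saLaw, traj, PMF.map_bind, PMF.map_comp, PMF.bind_map, PMF.bind_bind]
    congr 1
    funext τ
    simp only [Function.comp_def, Fin.snoc_last]

theorem stateLaw_congr (M : LinearMDP X A d) {π π' : Policy X A} {h : ℕ}
    (hπ : ∀ k < h, π k = π' k) : M.stateLaw π h = M.stateLaw π' h := by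
  induction h with
  | zero => rw [stateLaw_zero, stateLaw_zero]
  | succ k ih =>
    rw [stateLaw_succ, stateLaw_succ, saLaw_eq, saLaw_eq,
      ih fun j hj => hπ j (hj.trans (Nat.lt_succ_self k)), hπ k (Nat.lt_succ_self k)]

theorem stateLaw_comp (M : LinearMDP X A d) (π π' : Policy X A) (h : ℕ) :
    M.stateLaw (π.comp h π') h = M.stateLaw π h :=
  M.stateLaw_congr fun k hk => by simp [Policy.comp, hk]

theorem traj_succ_map_transition (M : LinearMDP X A d) (π : Policy X A) (h : ℕ) :
    ((M.traj π (h + 1)).map fun τ => ((τ (Fin.last h).castSucc).1,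
      (τ (Fin.last h).castSucc).2, (τ (Fin.last (h + 1))).1))
    = (M.saLaw π h).bind fun s => (M.trans h s.1 s.2).map fun x' => (s.1, s.2, x') := by
  simp only [saLaw, traj, PMF.map_bind, PMF.map_comp, PMF.bind_map]
  congr 1
  funext τ
  simp only [Function.comp_def, Fin.snoc_last, Fin.snoc_castSucc]
  conv_rhs => rw [← PMF.bind_pure_comp]
  congr 1
  funext x
  exact PMF.map_const _ _

theorem trans_apply_toReal (M : LinearMDP X A d) {h : ℕ} (hh : h + 1 < M.H) (x : X) (a : A)
    (x' : X) : (M.trans h x a x').toReal = dotProduct (M.φ h x a) (M.μ (h + 1) x') := by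
  have e : M.trans h x a x' = ENNReal.ofReal (dotProduct (M.φ h x a) (M.μ (h + 1) x')) :=
    DFunLike.congr_fun (dif_pos hh : M.trans h x a = _) x'
  rw [e]
  exact ENNReal.toReal_ofReal (M.trans_nonneg h hh x a x')

theorem trans_expect (M : LinearMDP X A d) {h : ℕ} (hh : h + 1 < M.H) (x : X) (a : A)
    (f : X → ℝ) : (M.trans h x a).expect f
      = ∑' x', dotProduct (M.φ h x a) (M.μ (h + 1) x') * f x' := by
  simp only [PMF.expect, M.trans_apply_toReal hh]

theorem abs_dotProduct_le {v u : Fin d → ℝ} {K : ℝ} (hv : ‖v‖ ≤ K) :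
    |dotProduct v u| ≤ K * l1norm u := by
  rw [dotProduct, l1norm, Finset.mul_sum]
  refine (Finset.abs_sum_le_sum_abs _ _).trans (Finset.sum_le_sum fun i _ => ?_)
  rw [abs_mul]
  exact mul_le_mul_of_nonneg_right ((norm_le_pi_norm v i).trans hv) (abs_nonneg _)

theorem l1norm_nonneg (u : Fin d → ℝ) : 0 ≤ l1norm u := Finset.sum_nonneg fun _ _ => abs_nonneg _

theorem abs_le_l1norm (u : Fin d → ℝ) (i : Fin d) : |u i| ≤ l1norm u :=
  Finset.single_le_sum (f := fun i => |u i|) (fun _ _ => abs_nonneg _) (Finset.mem_univ i)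

variable {M : LinearMDP X A d} {C : ℝ}

theorem L1Bounded.abs_dot_le (hM : M.L1Bounded C) {h : ℕ} (hh : h < M.H) (x : X) (a : A)
    (u : Fin d → ℝ) : |dotProduct (M.φ h x a) u| ≤ l1norm u := by
  simpa using abs_dotProduct_le (u := u) (hM.φ_le h hh x a)

theorem L1Bounded.abs_φ_le (hM : M.L1Bounded C) {h : ℕ} (hh : h < M.H) (x : X) (a : A)
    (l : Fin d) : |M.φ h x a l| ≤ 1 :=
  (norm_le_pi_norm (M.φ h x a) l).trans (hM.φ_le h hh x a)

theorem L1Bounded.abs_φavg_le [Fintype A] [Nonempty A] (hM : M.L1Bounded C) {h : ℕ}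
    (hh : h < M.H) (x : X) (l : Fin d) : |M.φavg h x l| ≤ 1 := by
  have hA : (0 : ℝ) < Fintype.card A := by exact_mod_cast Fintype.card_pos
  rw [φavg, abs_mul, abs_of_pos (by positivity), one_div, inv_mul_le_iff₀ hA]
  refine (Finset.abs_sum_le_sum_abs _ _).trans ?_
  refine (Finset.sum_le_card_nsmul _ _ 1 fun a _ => hM.abs_φ_le hh x a l).trans ?_
  simp

theorem L1Bounded.meanφ_dot (hM : M.L1Bounded C) {h : ℕ} (hh : h < M.H) (π : Policy X A)
    (u : Fin d → ℝ) : dotProduct (M.meanφ π h) u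
      = (M.saLaw π h).expect fun s => dotProduct (M.φ h s.1 s.2) u := by
  have hb : ∀ l, IsBddFun fun s : X × A => M.φ h s.1 s.2 l :=
    fun l => ⟨1, fun s => hM.abs_φ_le hh _ _ l⟩
  simp only [dotProduct]
  rw [PMF.expect_finset_sum _ _ fun l _ => (hb l).mul (.const _)]
  refine Finset.sum_congr rfl fun l _ => ?_
  simp only [mul_comm _ (u l)]
  rw [PMF.expect_const_mul, saLaw, PMF.expect_map _ _ (hb l)]
  rfl

theorem saLaw_expect (M : LinearMDP X A d) (π : Policy X A) (h : ℕ) {f : X × A → ℝ}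
    (hf : IsBddFun f) : (M.saLaw π h).expect f
      = (M.stateLaw π h).expect fun x => (π h x).expect fun a => f (x, a) := by
  rw [saLaw_eq, PMF.expect_bind _ _ hf]
  simp only [PMF.expect_map _ _ hf]

theorem toReal_apply_eq_expect {T : Type*} (p : PMF T) (t : T) [DecidableEq T] :
    (p t).toReal = p.expect fun s => if s = t then 1 else 0 := by
  rw [PMF.expect, tsum_eq_single t]
  · simp
  · intro s hs; simp [hs]

theorem isBddFun_ite {T : Type*} (P : T → Prop) [DecidablePred P] :
    IsBddFun fun t => if P t then (1 : ℝ) else 0 :=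
  ⟨1, fun t => by dsimp only; split_ifs <;> simp⟩

/-- Linearity of the dynamics: the policy enters the visitation density only through the features at
the previous step. -/
theorem visit_succ (M : LinearMDP X A d) (π : Policy X A) {k : ℕ} (hk : k + 1 < M.H) (x : X) :
    M.visit π (k + 1) x
      = (M.saLaw π k).expect fun s => dotProduct (M.φ k s.1 s.2) (M.μ (k + 1) x) := by
  classical
  rw [visit_eq, toReal_apply_eq_expect, stateLaw_succ, PMF.expect_bind _ _ (isBddFun_ite _)]
  congr 1
  funext s
  rw [← toReal_apply_eq_expect, M.trans_apply_toReal hk]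

theorem visit_nonneg (M : LinearMDP X A d) (π : Policy X A) (h : ℕ) (x : X) :
    0 ≤ M.visit π h x := ENNReal.toReal_nonneg

theorem toReal_apply_le_one {T : Type*} (p : PMF T) (t : T) : (p t).toReal ≤ 1 := by
  have := ENNReal.toReal_mono ENNReal.one_ne_top (p.coe_le_one t)
  simpa using this

/-- The largest probability with which a policy visits `x` at step `h`. -/
noncomputable def maxVisit (M : LinearMDP X A d) (h : ℕ) (x : X) : ℝ := ⨆ π, M.visit π h x

theorem visit_le_maxVisit (M : LinearMDP X A d) (π : Policy X A) (h : ℕ) (x : X) :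
    M.visit π h x ≤ M.maxVisit h x :=
  le_ciSup (f := fun π => M.visit π h x)
    ⟨1, by rintro _ ⟨π, rfl⟩; exact toReal_apply_le_one _ _⟩ π

theorem maxVisit_nonneg (M : LinearMDP X A d) (h : ℕ) (x : X) : 0 ≤ M.maxVisit h x :=
  Real.iSup_nonneg fun π => M.visit_nonneg π h x

/-- After a transition, d^π(x) = E^π⟨φ, μ(x)⟩ ≤ ‖μ(x)‖₁ for every π, and these norms sum to at most
C. At the initial step all policies share one law, of mass 1 ≤ C. -/
theorem L1Bounded.summable_maxVisit [Nonempty A] (hM : M.L1Bounded C) (hC : 1 ≤ C) {h : ℕ}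
    (hh : h < M.H) : Summable (M.maxVisit h) ∧ ∑' x, M.maxVisit h x ≤ C := by
  have : Nonempty (Policy X A) := ⟨fun _ _ => PMF.pure (Classical.arbitrary A)⟩
  cases h with
  | zero =>
    have e : M.maxVisit 0 = fun x => (M.init x).toReal := by
      funext x
      simp only [maxVisit, visit_eq, stateLaw_zero]
      exact ciSup_const
    rw [e]
    exact ⟨M.init.summable_toReal, by rw [M.init.tsum_toReal]; exact hC⟩
  | succ k =>
    have e : ∀ x, M.maxVisit (k + 1) x ≤ l1norm (M.μ (k + 1) x) := by
      intro x
      refine ciSup_le fun π => ?_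
      rw [M.visit_succ π hh]
      exact (le_abs_self _).trans
        (PMF.abs_expect_le _ fun s => hM.abs_dot_le (Nat.lt_of_succ_lt hh) _ _ _)
    have hs := Summable.of_nonneg_of_le (M.maxVisit_nonneg (k + 1)) e (hM.μ_summable k hh)
    exact ⟨hs, (hs.tsum_le_tsum e (hM.μ_summable k hh)).trans (hM.μ_le k hh)⟩

/-! ### Policy covers, thinning and change of measure -/

section sample

variable {h : ℕ} {Ψ : Finset (Policy X A)} {α : ℝ}

/-- The law of the state at step `h` under a policy drawn uniformly from `Ψ`. -/
noncomputable def coverLaw (M : LinearMDP X A d) (h : ℕ) (Ψ : Finset (Policy X A))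
    (hΨ : Ψ.Nonempty) : PMF X :=
  (PMF.uniformOfFinset Ψ hΨ).bind fun π => M.stateLaw π h

theorem coverLaw_toReal (M : LinearMDP X A d) (h : ℕ) (Ψ : Finset (Policy X A))
    (hΨ : Ψ.Nonempty) (x : X) :
    (M.coverLaw h Ψ hΨ x).toReal = (1 / (Ψ.card : ℝ)) * ∑ π ∈ Ψ, M.visit π h x := by
  classical
  rw [toReal_apply_eq_expect, coverLaw, PMF.expect_bind _ _ (isBddFun_ite _), PMF.expect,
    tsum_eq_sum (s := Ψ), Finset.mul_sum]
  · refine Finset.sum_congr rfl fun π hπ => ?_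
    rw [PMF.uniformOfFinset_apply_of_mem hΨ hπ, ← toReal_apply_eq_expect, visit_eq]
    simp
  · intro π hπ
    rw [PMF.uniformOfFinset_apply_of_notMem hΨ hπ]
    simp

/-- The thinning weight of a state: the ratio of its guaranteed and its actual coverage. -/
noncomputable def weight (M : LinearMDP X A d) (h : ℕ) (Ψ : Finset (Policy X A))
    (hΨ : Ψ.Nonempty) (α : ℝ) (x : X) : ℝ :=
  α * M.maxVisit h x / (M.coverLaw h Ψ hΨ x).toReal

theorem weight_nonneg (M : LinearMDP X A d) (hΨ : Ψ.Nonempty) (hα : 0 < α) (x : X) :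
    0 ≤ M.weight h Ψ hΨ α x :=
  div_nonneg (mul_nonneg hα.le (M.maxVisit_nonneg h x)) ENNReal.toReal_nonneg

theorem PolicyCover.mul_maxVisit_le (hcov : M.PolicyCover α h Ψ) (hΨ : Ψ.Nonempty)
    (hα : 0 < α) (x : X) : α * M.maxVisit h x ≤ (M.coverLaw h Ψ hΨ x).toReal := by
  have : Nonempty (Policy X A) := ⟨hΨ.choose⟩
  rw [coverLaw_toReal, ← le_div_iff₀' hα]
  refine ciSup_le fun π => ?_
  rw [le_div_iff₀' hα]
  exact hcov x π

theorem PolicyCover.weight_le_one (hcov : M.PolicyCover α h Ψ) (hΨ : Ψ.Nonempty)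
    (hα : 0 < α) (x : X) : M.weight h Ψ hΨ α x ≤ 1 :=
  div_le_one_of_le₀ (hcov.mul_maxVisit_le hΨ hα x) ENNReal.toReal_nonneg

/-- At states of zero coverage the weight is the default 0/0 = 0; the cover property forces
`maxVisit` to vanish there, so nothing is lost. -/
theorem PolicyCover.coverLaw_mul_weight (hcov : M.PolicyCover α h Ψ) (hΨ : Ψ.Nonempty)
    (hα : 0 < α) (x : X) :
    (M.coverLaw h Ψ hΨ x).toReal * M.weight h Ψ hΨ α x = α * M.maxVisit h x := by
  rcases eq_or_ne (M.coverLaw h Ψ hΨ x).toReal 0 with h0 | h0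
  · rw [h0, zero_mul]
    refine le_antisymm (mul_nonneg hα.le (M.maxVisit_nonneg h x)) ?_
    rw [← h0]
    exact hcov.mul_maxVisit_le hΨ hα x
  · rw [weight]
    field_simp

theorem PolicyCover.isBddFun_weight (hcov : M.PolicyCover α h Ψ) (hΨ : Ψ.Nonempty)
    (hα : 0 < α) : IsBddFun (M.weight h Ψ hΨ α) :=
  ⟨1, fun x => by
    rw [abs_of_nonneg (M.weight_nonneg hΨ hα x)]
    exact hcov.weight_le_one hΨ hα x⟩

variable [Fintype A] [Nonempty A]

theorem sampleLaw_eq (M : LinearMDP X A d) (h : ℕ) (Ψ : Finset (Policy X A)) (hΨ : Ψ.Nonempty) :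
    M.sampleLaw h Ψ hΨ = (M.coverLaw h Ψ hΨ).bind fun x =>
      (PMF.uniformOfFintype A).bind fun a => (M.trans h x a).map fun x' => (x, a, x') := by
  simp only [sampleLaw, coverLaw, traj_succ_map_transition, saLaw_eq, stateLaw_comp,
    PMF.bind_bind, PMF.bind_map]
  simp [Policy.comp, Policy.unif, Function.comp_def]

theorem sampleLaw_expect (M : LinearMDP X A d) (hΨ : Ψ.Nonempty) {f : X × A × X → ℝ}
    (hf : IsBddFun f) : (M.sampleLaw h Ψ hΨ).expect f
      = (M.coverLaw h Ψ hΨ).expect fun x => (1 / (Fintype.card A : ℝ)) *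
          ∑ a, (M.trans h x a).expect fun x' => f (x, a, x') := by
  rw [sampleLaw_eq, PMF.expect_bind _ _ hf]
  congr 1
  funext x
  rw [PMF.expect_bind _ _ hf, PMF.expect_uniformOfFintype]
  simp only [PMF.expect_map _ _ hf]

/-- Thinning turns the coverage into exactly α `maxVisit`, whose total mass is at most αC. This
factor α later cancels against the one in the margin threshold. -/
theorem PolicyCover.expect_weight_le (hcov : M.PolicyCover α h Ψ) (hΨ : Ψ.Nonempty)
    (hα : 0 < α) (hM : M.L1Bounded C) (hC : 1 ≤ C) (hh : h < M.H) :
    (M.sampleLaw h Ψ hΨ).expect (fun s => M.weight h Ψ hΨ α s.1) ≤ α * C := by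
  have hA : (Fintype.card A : ℝ) ≠ 0 := by exact_mod_cast Fintype.card_ne_zero
  rw [M.sampleLaw_expect hΨ ((hcov.isBddFun_weight hΨ hα).comp Prod.fst)]
  simp only [PMF.expect_const, Finset.sum_const, Finset.card_univ, nsmul_eq_mul]
  simp only [← mul_assoc, one_div_mul_cancel hA, one_mul]
  simp only [PMF.expect, hcov.coverLaw_mul_weight hΨ hα, tsum_mul_left]
  exact mul_le_mul_of_nonneg_left (hM.summable_maxVisit hC hh).2 hα.le

/-- Change of measure from a policy to the weighted sampling law. -/
theorem PolicyCover.expect_le (hcov : M.PolicyCover α h Ψ) (hΨ : Ψ.Nonempty)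
    (hα : 0 < α) (hM : M.L1Bounded C) (hC : 1 ≤ C) (hh : h < M.H) (π : Policy X A)
    {f : X × A → ℝ} (hf : IsBddFun f) (hf0 : ∀ s, 0 ≤ f s) :
    (M.saLaw π h).expect f ≤ (Fintype.card A / α) *
      (M.sampleLaw h Ψ hΨ).expect fun s => M.weight h Ψ hΨ α s.1 * f (s.1, s.2.1) := by
  have hA : (Fintype.card A : ℝ) ≠ 0 := by exact_mod_cast Fintype.card_ne_zero
  obtain ⟨K, hK⟩ := id hf
  have hsum : IsBddFun fun x => ∑ a, f (x, a) :=
    IsBddFun.sum _ fun a _ => hf.comp fun x => (x, a)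
  -- Every action probability is at most 1, that is, A times the uniform one; this is the source of
  -- the factor A.
  have hinner : ∀ x, (π h x).expect (fun a => f (x, a)) ≤ ∑ a, f (x, a) := by
    intro x
    rw [PMF.expect, tsum_fintype]
    refine Finset.sum_le_sum fun a _ => ?_
    exact mul_le_of_le_one_left (hf0 _) (toReal_apply_le_one _ _)
  have hbi : IsBddFun fun x => (π h x).expect (fun a => f (x, a)) :=
    ⟨K, fun x => PMF.abs_expect_le _ fun a => hK _⟩
  rw [saLaw_expect _ _ _ hf, M.sampleLaw_expect hΨ
    (((hcov.isBddFun_weight hΨ hα).comp Prod.fst).mul (hf.comp fun s => (s.1, s.2.1)))]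
  simp only [PMF.expect_const, ← Finset.mul_sum]
  refine (PMF.expect_mono _ hbi hsum hinner).trans ?_
  rw [PMF.expect_const_mul]
  simp only [PMF.expect, ← mul_assoc, hcov.coverLaw_mul_weight hΨ hα]
  simp only [mul_assoc, tsum_mul_left]
  rw [show ∀ S : ℝ, Fintype.card A / α * (1 / Fintype.card A * (α * S)) = S from
    fun S => by field_simp]
  refine Summable.tsum_le_tsum (fun x => ?_) (PMF.summable_mul _ hsum) ?_
  · exact mul_le_mul_of_nonneg_right (M.visit_le_maxVisit π h x)
      (Finset.sum_nonneg fun a _ => hf0 _)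
  · obtain ⟨L, hL⟩ := hsum
    refine Summable.of_norm_bounded ((hM.summable_maxVisit hC hh).1.mul_right L) fun x => ?_
    rw [norm_mul, Real.norm_of_nonneg (M.maxVisit_nonneg h x), Real.norm_eq_abs]
    exact mul_le_mul_of_nonneg_left (hL x) (M.maxVisit_nonneg h x)

theorem PolicyCover.expect_le' (hcov : M.PolicyCover α h Ψ) (hΨ : Ψ.Nonempty)
    (hα : 0 < α) (hM : M.L1Bounded C) (hC : 1 ≤ C) (hh : h < M.H) (π : Policy X A)
    {f : X × A → ℝ} (hf : IsBddFun f) (hf0 : ∀ s, 0 ≤ f s) :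
    (M.saLaw π h).expect f ≤ (Fintype.card A / α) *
      (M.sampleLaw h Ψ hΨ).expect fun s => f (s.1, s.2.1) := by
  refine (hcov.expect_le hΨ hα hM hC hh π hf hf0).trans ?_
  have hf' : IsBddFun fun s : X × A × X => f (s.1, s.2.1) := hf.comp _
  refine mul_le_mul_of_nonneg_left (PMF.expect_mono _
    (((hcov.isBddFun_weight hΨ hα).comp Prod.fst).mul hf') hf' fun s => ?_) (by positivity)
  exact mul_le_of_le_one_left (hf0 _) (hcov.weight_le_one hΨ hα _)

/-- Change of measure tested on the constant function 1. -/
theorem PolicyCover.le_card (hcov : M.PolicyCover α h Ψ) (hΨ : Ψ.Nonempty)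
    (hα : 0 < α) (hM : M.L1Bounded C) (hC : 1 ≤ C) (hh : h < M.H) :
    α ≤ Fintype.card A := by
  have := hcov.expect_le' hΨ hα hM hC hh hΨ.choose (f := fun _ => 1) (.const _)
    fun _ => zero_le_one
  rw [PMF.expect_const, PMF.expect_const, mul_one] at this
  exact (one_le_div hα).1 this

/-- The law of the successor state in a sample. -/
noncomputable def nextLaw (M : LinearMDP X A d) (h : ℕ) (Ψ : Finset (Policy X A))
    (hΨ : Ψ.Nonempty) : PMF X := (M.sampleLaw h Ψ hΨ).map fun s => s.2.2

theorem nextLaw_toReal (M : LinearMDP X A d) (hΨ : Ψ.Nonempty) (hM : M.L1Bounded C)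
    (hh : h + 1 < M.H) (x' : X) : (M.nextLaw h Ψ hΨ x').toReal
      = (M.sampleLaw h Ψ hΨ).expect
          fun s => dotProduct (M.φ h s.1 s.2.1) (M.μ (h + 1) x') := by
  classical
  rw [toReal_apply_eq_expect, nextLaw, PMF.expect_map _ _ (isBddFun_ite _),
    M.sampleLaw_expect hΨ (isBddFun_ite _), M.sampleLaw_expect hΨ
      ⟨_, fun s => hM.abs_dot_le (Nat.lt_of_succ_lt hh) _ _ _⟩]
  simp only [← toReal_apply_eq_expect, M.trans_apply_toReal hh, PMF.expect_const]

/-- The policy that reaches x' is itself dominated by the sampling law. The resulting bound on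
‖μ(x')‖₁ relative to the density of x' is what makes importance weighting possible. -/
theorem Reachable.mul_l1norm_le {η : ℝ} (hη : M.Reachable η) (hcov : M.PolicyCover α h Ψ)
    (hΨ : Ψ.Nonempty) (hα : 0 < α) (hM : M.L1Bounded C) (hC : 1 ≤ C) (hh : h + 1 < M.H)
    (x' : X) : η * l1norm (M.μ (h + 1) x')
      ≤ (Fintype.card A / α) * (M.nextLaw h Ψ hΨ x').toReal := by
  obtain ⟨π, hπ⟩ := hη h hh x'
  refine hπ.trans ?_
  have hlt := Nat.lt_of_succ_lt hh
  rw [M.visit_succ π hh, M.nextLaw_toReal hΨ hM hh]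
  exact hcov.expect_le' hΨ hα hM hC hlt π
    (f := fun s => dotProduct (M.φ h s.1 s.2) (M.μ (h + 1) x'))
    ⟨_, fun s => hM.abs_dot_le hlt _ _ _⟩ fun s => M.trans_nonneg h hh _ _ _

end sample

end LinearMDP

/-! ### Union bounds and the probabilistic method -/

namespace PMF

variable {T S : Type*}

theorem toOuterMeasure_iUnion_le (p : PMF T) {ι : Type*} [Fintype ι] (E : ι → Set T) {c : ℝ}
    (h : ∀ i, p.toOuterMeasure (E i) ≤ ENNReal.ofReal c) :
    p.toOuterMeasure (⋃ i, E i) ≤ ENNReal.ofReal (Fintype.card ι * c) := by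
  refine (MeasureTheory.measure_iUnion_fintype_le _ _).trans ?_
  refine (Finset.sum_le_sum fun i _ => h i).trans (le_of_eq ?_)
  rw [Finset.sum_const, nsmul_eq_mul, ENNReal.ofReal_mul (by positivity), ENNReal.ofReal_natCast]
  rfl

theorem toOuterMeasure_union_le (p : PMF T) {E F : Set T} {a b : ℝ} (ha : 0 ≤ a) (hb : 0 ≤ b)
    (hE : p.toOuterMeasure E ≤ ENNReal.ofReal a) (hF : p.toOuterMeasure F ≤ ENNReal.ofReal b) :
    p.toOuterMeasure (E ∪ F) ≤ ENNReal.ofReal (a + b) := by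
  rw [ENNReal.ofReal_add ha hb]
  exact (MeasureTheory.measure_union_le _ _).trans (add_le_add hE hF)

open Classical in
theorem expect_indicator (p : PMF T) (E : Set T) :
    p.expect (fun t => if t ∈ E then 1 else 0) = (p.toOuterMeasure E).toReal := by
  rw [PMF.toOuterMeasure_apply, ENNReal.tsum_toReal_eq]
  · refine tsum_congr fun t => ?_
    by_cases h : t ∈ E <;> simp [h]
  · intro t
    by_cases h : t ∈ E <;> simp [h, p.apply_ne_top]

theorem exists_le_of_expect_le [Fintype T] (p : PMF T) {F : T → ℝ} {K : ℝ}
    (h : p.expect F ≤ K) : ∃ t, F t ≤ K := by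
  by_contra! hc
  have hF : IsBddFun F := ⟨∑ t, |F t|, fun t =>
    Finset.single_le_sum (f := fun t => |F t|) (fun _ _ => abs_nonneg _) (Finset.mem_univ t)⟩
  obtain ⟨t, ht⟩ := p.support_nonempty
  have hpos : 0 < (p t).toReal :=
    ENNReal.toReal_pos ((p.mem_support_iff t).1 ht) (p.apply_ne_top t)
  have h1 : 0 < p.expect fun t => F t - K := by
    rw [expect, tsum_fintype]
    exact Finset.sum_pos' (fun s _ => mul_nonneg ENNReal.toReal_nonneg (sub_nonneg.2 (hc s).le))
      ⟨t, Finset.mem_univ t, mul_pos hpos (sub_pos.2 (hc t))⟩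
  rw [p.expect_sub hF (.const K), p.expect_const] at h1
  linarith

theorem expect_comm [Fintype S] (q : PMF S) (p : PMF T) {F : S → T → ℝ}
    (hF : ∀ s, IsBddFun (F s)) :
    q.expect (fun s => p.expect (F s)) = p.expect fun t => q.expect fun s => F s t := by
  have e : ∀ f, q.expect f = ∑ s, (q s).toReal * f s := fun f => tsum_fintype _
  simp only [e]
  rw [p.expect_finset_sum _ fun s _ => (hF s).const_mul _]
  simp only [p.expect_const_mul]

/-- Two-sided Hoeffding inequality. -/
theorem iid_hoeffding_abs (p : PMF T) {f : T → ℝ} {b : ℝ} (hb : 0 < b)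
    (hf : ∀ t, |f t| ≤ b) (h0 : p.expect f = 0) (n : ℕ) {r : ℝ} (hr : 0 < r) :
    (p.iid n).toOuterMeasure {s | n * r ≤ |∑ i, f (s i)|}
      ≤ ENNReal.ofReal (2 * Real.exp (-(n * r ^ 2 / (2 * b ^ 2)))) := by
  have h1 := p.iid_hoeffding hb hf h0 n hr
  have h2 := p.iid_hoeffding (f := fun t => - f t) hb (fun t => by rw [abs_neg]; exact hf t)
    (by rw [p.expect_neg, h0, neg_zero]) n hr
  have h3 := toOuterMeasure_union_le _ (Real.exp_pos _).le (Real.exp_pos _).le h1 h2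
  rw [two_mul]
  refine le_trans (MeasureTheory.measure_mono fun s hs => ?_) h3
  rcases le_abs'.1 (show n * r ≤ |∑ i, f (s i)| from hs) with h | h
  · right
    show n * r ≤ ∑ i, - f (s i)
    rw [Finset.sum_neg_distrib]
    linarith
  · left
    exact h

end PMF

/-! ### Maurey sparsification and the one-sided margin bound -/

namespace LinearMDP

variable {T : Type*} {d : ℕ}

/-- The inner product of `x` with the signed basis vector encoded by `q`. -/
def signedCoord (x : Fin d → ℝ) (q : Fin d × Bool) : ℝ := if q.2 then x q.1 else - x q.1

theorem abs_signedCoord_le {x : Fin d → ℝ} (hx : ‖x‖ ≤ 1) (q : Fin d × Bool) :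
    |signedCoord x q| ≤ 1 := by
  have := (norm_le_pi_norm x q.1).trans hx
  rw [Real.norm_eq_abs] at this
  rw [signedCoord]
  split_ifs
  · exact this
  · rwa [abs_neg]

/-- The distribution on signed basis vectors whose barycentre is `u`. -/
noncomputable def signedLaw (u : Fin d → ℝ) (hu : l1norm u = 1) : PMF (Fin d × Bool) :=
  PMF.ofFintype (fun q => ENNReal.ofReal (max (signedCoord u q) 0)) (by
    rw [← ENNReal.ofReal_sum_of_nonneg fun q _ => le_max_right _ _, Fintype.sum_prod_type]
    simp only [Fintype.sum_bool, signedCoord, if_true, Bool.false_eq_true, if_false]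
    rw [← ENNReal.ofReal_one, ← hu, l1norm]
    congr 1
    refine Finset.sum_congr rfl fun i _ => ?_
    rcases le_total 0 (u i) with h | h
    · rw [max_eq_left h, max_eq_right (by linarith), abs_of_nonneg h, add_zero]
    · rw [max_eq_right h, max_eq_left (by linarith), abs_of_nonpos h, zero_add])

theorem signedLaw_expect (u : Fin d → ℝ) (hu : l1norm u = 1) (x : Fin d → ℝ) :
    (signedLaw u hu).expect (signedCoord x) = dotProduct x u := by
  rw [PMF.expect, tsum_fintype, Fintype.sum_prod_type, dotProduct]
  refine Finset.sum_congr rfl fun i _ => ?_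
  simp only [Fintype.sum_bool, signedLaw, PMF.ofFintype_apply, signedCoord, if_true,
    Bool.false_eq_true, if_false]
  rw [ENNReal.toReal_ofReal (le_max_right _ _), ENNReal.toReal_ofReal (le_max_right _ _)]
  rcases le_total 0 (u i) with h | h
  · rw [max_eq_left h, max_eq_right (by linarith)]
    ring
  · rw [max_eq_right h, max_eq_left (by linarith)]
    ring

/-- The average of `k` random signed basis vectors approximates `u` on any given point. -/
theorem signedLaw_tail (u : Fin d → ℝ) (hu : l1norm u = 1) {x : Fin d → ℝ} (hx : ‖x‖ ≤ 1)
    (k : ℕ) {ε : ℝ} (hε : 0 < ε) :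
    ((signedLaw u hu).iid k).toOuterMeasure
        {v | k * (ε / 4) ≤ |∑ j, signedCoord x (v j) - k * dotProduct x u|}
      ≤ ENNReal.ofReal (2 * Real.exp (-(k * ε ^ 2 / 128))) := by
  have hb : IsBddFun (signedCoord x) := ⟨1, abs_signedCoord_le hx⟩
  have hdot : |dotProduct x u| ≤ 1 := by
    simpa [hu] using abs_dotProduct_le (u := u) hx
  have h := (signedLaw u hu).iid_hoeffding_abs (f := fun q => signedCoord x q - dotProduct x u)
    two_pos (fun q => (abs_sub _ _).trans (by linarith [abs_signedCoord_le hx q]))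
    (by rw [PMF.expect_sub _ hb (.const _), PMF.expect_const, signedLaw_expect, sub_self])
    k (show 0 < ε / 4 by positivity)
  simp only [Finset.sum_sub_distrib, Finset.sum_const, Finset.card_univ, Fintype.card_fin,
    nsmul_eq_mul] at h
  refine h.trans (le_of_eq ?_)
  congr 4
  ring

open Classical in
/-- Uniform one-sided margin bound: with high probability, every `ℓ₁`-normalized linear functional
that is nonnegative on the sample is rarely very negative under the thinned law. -/
theorem margin_bound (p : PMF T) {w : T → ℝ} (hw0 : ∀ t, 0 ≤ w t) (hw1 : ∀ t, w t ≤ 1)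
    {ψ : T → Fin d → ℝ} (hψ : ∀ t, ‖ψ t‖ ≤ 1) {K ε τ : ℝ} (hwK : p.expect w ≤ K)
    (hε : 0 < ε) {k n : ℕ} (hn : 0 < n)
    (hk : 96 * K * Real.exp (-(k * ε ^ 2 / 128)) ≤ τ) :
    (p.iid n).toOuterMeasure {s | ∃ u, l1norm u = 1 ∧ (∀ i, 0 ≤ dotProduct (ψ (s i)) u) ∧
        τ < p.expect fun t => w t * if dotProduct (ψ t) u < -ε / 2 then 1 else 0}
      ≤ ENNReal.ofReal (Real.exp (-(n * K)) + (2 * d) ^ k * Real.exp (-(n * τ / 8))) := by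
  set σ : ℝ := 2 * Real.exp (-(k * ε ^ 2 / 128)) with hσ
  have hnR : (0 : ℝ) < n := by exact_mod_cast hn
  have hσ0 : 0 ≤ σ := by positivity
  have hwB : IsBddFun w := ⟨1, fun t => by rw [abs_of_nonneg (hw0 t)]; exact hw1 t⟩
  let V := Fin k → Fin d × Bool
  -- The threshold -ε/4 for the sparse average lies midway between the bad level -ε/2 and the level
  -- 0 guaranteed on the sample, so an approximation error below ε/4 cannot confuse the two.
  let far : V → T → ℝ := fun v t => if - (k * ε / 4) > ∑ j, signedCoord (ψ t) (v j) then 1 else 0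
  have hfar0 : ∀ v t, 0 ≤ far v t := fun v t => by dsimp only [far]; split_ifs <;> norm_num
  have hfar1 : ∀ v t, far v t ≤ 1 := fun v t => by dsimp only [far]; split_ifs <;> norm_num
  have hfarB : ∀ v, IsBddFun (far v) := fun v =>
    ⟨1, fun t => by rw [abs_of_nonneg (hfar0 v t)]; exact hfar1 v t⟩
  -- A sparse vector deceives the sample if its far set has thinned mass at least τ/2 but at most a
  -- quarter of this empirically. The event does not mention u, so a union over (2d)^k vectors
  -- covers all u.
  let E : V → Set (Fin n → T) := fun v =>
    {s | τ / 2 ≤ p.expect (fun t => w t * far v t) ∧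
      ∑ i, w (s i) * far v (s i) ≤ n * (τ / 2) / 4}
  have hE : ∀ v, (p.iid n).toOuterMeasure (E v) ≤ ENNReal.ofReal (Real.exp (-(n * τ / 8))) := by
    intro v
    by_cases hv : τ / 2 ≤ p.expect (fun t => w t * far v t)
    · have := p.iid_lower_tail (f := fun t => w t * far v t)
        (fun t => mul_nonneg (hw0 t) (hfar0 v t))
        (fun t => mul_le_one₀ (hw1 t) (hfar0 v t) (hfar1 v t)) hv n
      rw [show (n : ℝ) * (τ / 2) / 4 = n * τ / 8 by ring] at this
      refine le_trans (MeasureTheory.measure_mono fun s hs => ?_) this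
      have h2 : ∑ i, w (s i) * far v (s i) ≤ n * (τ / 2) / 4 := hs.2
      show ∑ i, w (s i) * far v (s i) ≤ n * τ / 8
      linarith
    · have : E v = ∅ := Set.eq_empty_of_forall_notMem fun s hs => hv hs.1
      rw [this]
      simp
  have hU := (p.iid n).toOuterMeasure_iUnion_le E hE
  have hcard : (Fintype.card V : ℝ) = (2 * d) ^ k := by
    simp only [V, Fintype.card_fun, Fintype.card_prod, Fintype.card_fin, Fintype.card_bool]
    push_cast
    ring
  rw [hcard] at hU
  have hall := PMF.toOuterMeasure_union_le _ (Real.exp_pos _).le (by positivity)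
    (p.iid_upper_tail hw0 hw1 hwK n) hU
  refine le_trans (MeasureTheory.measure_mono ?_) hall
  rintro s ⟨u, hu, hpos, hτ⟩
  by_contra hs
  simp only [Set.mem_union, Set.mem_iUnion, not_or, not_exists] at hs
  obtain ⟨hs1, hs2⟩ := hs
  have hs1 : ∑ i, w (s i) < 3 * n * K := not_le.1 hs1
  -- Indicator that the sparse average misses the value of u at the point t by at least ε/4.
  let B : V → T → ℝ := fun v t =>
    if k * (ε / 4) ≤ |∑ j, signedCoord (ψ t) (v j) - k * dotProduct (ψ t) u| then 1 else 0
  have hB0 : ∀ v t, 0 ≤ B v t := fun v t => by dsimp only [B]; split_ifs <;> norm_num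
  have hB1 : ∀ v t, B v t ≤ 1 := fun v t => by dsimp only [B]; split_ifs <;> norm_num
  have hBB : ∀ v, IsBddFun (B v) := fun v =>
    ⟨1, fun t => by rw [abs_of_nonneg (hB0 v t)]; exact hB1 v t⟩
  set q := (signedLaw u hu).iid k with hq
  have hBσ : ∀ t, q.expect (fun v => B v t) ≤ σ := by
    intro t
    have h1 := signedLaw_tail u hu (hψ t) k hε
    have h2 := q.expect_indicator
      {v | k * (ε / 4) ≤ |∑ j, signedCoord (ψ t) (v j) - k * dotProduct (ψ t) u|}
    simp only [Set.mem_ofPred_eq] at h2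
    show q.expect (fun v => if k * (ε / 4) ≤ |∑ j, signedCoord (ψ t) (v j) -
      k * dotProduct (ψ t) u| then 1 else 0) ≤ σ
    rw [h2]
    exact ENNReal.toReal_le_of_le_ofReal hσ0 h1
  have hBV : ∀ t, IsBddFun fun v => B v t := fun t =>
    ⟨1, fun v => by rw [abs_of_nonneg (hB0 v t)]; exact hB1 v t⟩
  have hF1 : q.expect (fun v => p.expect fun t => w t * B v t) ≤ σ * K := by
    rw [PMF.expect_comm q p fun v => hwB.mul (hBB v)]
    simp only [PMF.expect_const_mul]
    calc p.expect (fun t => w t * q.expect fun v => B v t)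
        ≤ p.expect (fun t => σ * w t) := by
          refine p.expect_mono (hwB.mul ⟨1, fun t => ?_⟩) (hwB.const_mul σ) fun t => ?_
          · exact PMF.abs_expect_le _ fun v => by
              rw [abs_of_nonneg (hB0 v t)]; exact hB1 v t
          · rw [mul_comm]
            exact mul_le_mul_of_nonneg_right (hBσ t) (hw0 t)
      _ ≤ σ * K := by
          rw [p.expect_const_mul]
          exact mul_le_mul_of_nonneg_left hwK hσ0
  have hF2 : q.expect (fun v => ∑ i, w (s i) * B v (s i)) ≤ σ * (3 * n * K) := by
    rw [q.expect_finset_sum (F := fun i v => w (s i) * B v (s i)) _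
      fun i _ => (hBV (s i)).const_mul _]
    have e : ∀ i, q.expect (fun v => w (s i) * B v (s i))
        = w (s i) * q.expect fun v => B v (s i) := fun i => q.expect_const_mul _ _
    simp only [e]
    calc ∑ i, w (s i) * q.expect (fun v => B v (s i)) ≤ ∑ i, w (s i) * σ :=
          Finset.sum_le_sum fun i _ => mul_le_mul_of_nonneg_left (hBσ _) (hw0 _)
      _ = σ * ∑ i, w (s i) := by rw [← Finset.sum_mul, mul_comm]
      _ ≤ σ * (3 * n * K) := mul_le_mul_of_nonneg_left hs1.le hσ0
  have hbdd : ∀ F : V → ℝ, IsBddFun F := fun F => ⟨∑ t, |F t|, fun t =>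
    Finset.single_le_sum (f := fun t => |F t|) (fun _ _ => abs_nonneg _) (Finset.mem_univ t)⟩
  -- A single v must approximate u well both under the thinned law and on the sample. The factor 3n
  -- balances the two error masses: each contributes at most 3nσK on average.
  obtain ⟨v, hv⟩ := q.exists_le_of_expect_le (K := 6 * n * (σ * K))
    (F := fun v => 3 * n * p.expect (fun t => w t * B v t) + ∑ i, w (s i) * B v (s i)) (by
      rw [q.expect_add (hbdd _) (hbdd _), q.expect_const_mul]
      nlinarith [mul_le_mul_of_nonneg_left hF1 hnR.le])
  have hv1 : 0 ≤ p.expect (fun t => w t * B v t) :=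
    p.expect_nonneg fun t => mul_nonneg (hw0 t) (hB0 v t)
  have hv2 : 0 ≤ ∑ i, w (s i) * B v (s i) :=
    Finset.sum_nonneg fun i _ => mul_nonneg (hw0 _) (hB0 v _)
  have hσK : 48 * (σ * K) ≤ τ := by rw [hσ]; linarith
  have hv3 : p.expect (fun t => w t * B v t) ≤ 2 * (σ * K) := by
    have : n * p.expect (fun t => w t * B v t) ≤ n * (2 * (σ * K)) := by linarith
    exact le_of_mul_le_mul_left this hnR
  have hK0 : 0 ≤ K := (p.expect_nonneg hw0).trans hwK
  refine hs2 v ⟨?_, ?_⟩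
  -- Points bad for u are far for v unless approximated badly. The latter carry mass at most 2σK ≤
  -- τ/24, so more than τ/2 of the mass τ remains.
  · have h1 : ∀ t, (w t * if dotProduct (ψ t) u < -ε / 2 then 1 else 0)
        ≤ w t * far v t + w t * B v t := by
      intro t
      rw [← mul_add]
      refine mul_le_mul_of_nonneg_left ?_ (hw0 t)
      by_cases hB : k * (ε / 4) ≤ |∑ j, signedCoord (ψ t) (v j) - k * dotProduct (ψ t) u|
      · have : B v t = 1 := if_pos hB
        rw [this]
        have := hfar0 v t
        split_ifs <;> linarith
      · by_cases hg : dotProduct (ψ t) u < -ε / 2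
        · have : far v t = 1 := by
            refine if_pos ?_
            have h2 := (abs_lt.1 (not_le.1 hB)).2
            have h3 := mul_le_mul_of_nonneg_left hg.le (Nat.cast_nonneg (α := ℝ) k)
            linarith
          rw [this, if_pos hg]
          linarith [hB0 v t]
        · rw [if_neg hg]
          exact add_nonneg (hfar0 v t) (hB0 v t)
    have h2 := p.expect_mono (hwB.mul (isBddFun_ite _))
      ((hwB.mul (hfarB v)).add (hwB.mul (hBB v))) h1
    rw [p.expect_add (hwB.mul (hfarB v)) (hwB.mul (hBB v))] at h2
    nlinarith [mul_nonneg hσ0 hK0]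
  -- As u is nonnegative on the sample, a sample point can be far only through bad approximation;
  -- the empirical mass is thus at most 6nσK ≤ nτ/8, which places the sample in `E v`.
  · have h1 : ∑ i, w (s i) * far v (s i) ≤ ∑ i, w (s i) * B v (s i) := by
      refine Finset.sum_le_sum fun i _ => mul_le_mul_of_nonneg_left ?_ (hw0 _)
      by_cases hf : - (k * ε / 4) > ∑ j, signedCoord (ψ (s i)) (v j)
      · have : B v (s i) = 1 := by
          refine if_pos ?_
          have h3 := mul_nonneg (Nat.cast_nonneg (α := ℝ) k) (hpos i)
          rw [le_abs']
          left
          linarith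
        rw [this]
        exact hfar1 v _
      · have : far v (s i) = 0 := if_neg hf
        rw [this]
        exact hB0 v _
    have h2 : ∑ i, w (s i) * B v (s i) ≤ 6 * n * (σ * K) := by
      nlinarith [mul_nonneg hnR.le hv1]
    nlinarith [mul_le_mul_of_nonneg_left hσK hnR.le]

end LinearMDP

/-! ### Least squares and second moments under ℓ₁ constraints -/

namespace PMF

variable {T : Type*}

theorem iid_hoeffding_family (p : PMF T) {ι : Type*} [Fintype ι] {f : ι → T → ℝ}
    (hf : ∀ i t, |f i t| ≤ 2) (h0 : ∀ i, p.expect (f i) = 0) (n : ℕ) {r : ℝ} (hr : 0 < r) :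
    (p.iid n).toOuterMeasure {s | ∃ i, n * r ≤ |∑ j, f i (s j)|}
      ≤ ENNReal.ofReal (Fintype.card ι * (2 * Real.exp (-(n * r ^ 2 / 8)))) := by
  have h := (p.iid n).toOuterMeasure_iUnion_le (fun i => {s | n * r ≤ |∑ j, f i (s j)|})
    fun i => p.iid_hoeffding_abs two_pos (hf i) (h0 i) n hr
  refine le_trans (MeasureTheory.measure_mono ?_) (h.trans (le_of_eq ?_))
  · rintro s ⟨i, hi⟩
    exact Set.mem_iUnion.2 ⟨i, hi⟩
  · congr 5
    ring

end PMF

theorem l1norm_sub_le {d : ℕ} (u v : Fin d → ℝ) : l1norm (u - v) ≤ l1norm u + l1norm v := by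
  simp only [l1norm, ← Finset.sum_add_distrib]
  exact Finset.sum_le_sum fun i _ => abs_sub _ _

theorem l1norm_add_le {d : ℕ} (u v : Fin d → ℝ) : l1norm (u + v) ≤ l1norm u + l1norm v := by
  simp only [l1norm, ← Finset.sum_add_distrib]
  exact Finset.sum_le_sum fun i _ => abs_add_le _ _

theorem l1norm_smul {d : ℕ} (c : ℝ) (u : Fin d → ℝ) : l1norm (c • u) = |c| * l1norm u := by
  simp only [l1norm, Finset.mul_sum, Pi.smul_apply, smul_eq_mul, abs_mul]

theorem l1norm_sum_le {d : ℕ} {ι : Type*} (s : Finset ι) (v : ι → Fin d → ℝ) :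
    l1norm (∑ j ∈ s, v j) ≤ ∑ j ∈ s, l1norm (v j) := by
  simp only [l1norm]
  rw [Finset.sum_comm]
  refine Finset.sum_le_sum fun i _ => ?_
  rw [Finset.sum_apply]
  exact Finset.abs_sum_le_sum_abs _ _

theorem continuous_l1norm {d : ℕ} : Continuous (l1norm : (Fin d → ℝ) → ℝ) :=
  continuous_finsetSum _ fun i _ => (continuous_apply i).abs

/-- Basic inequality for `ℓ₁`-constrained least squares. -/
theorem sum_sq_le_of_isMin {d n : ℕ} {C r : ℝ} {x : Fin n → Fin d → ℝ} {y : Fin n → ℝ}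
    {v w : Fin d → ℝ} (hv : l1norm v ≤ C) (hw : l1norm w ≤ C) (hr : 0 ≤ r)
    (hmin : ∑ i, (dotProduct (x i) v - y i) ^ 2 ≤ ∑ i, (dotProduct (x i) w - y i) ^ 2)
    (hnoise : ∀ k, |∑ i, (y i - dotProduct (x i) w) * x i k| ≤ r) :
    ∑ i, (dotProduct (x i) w - dotProduct (x i) v) ^ 2 ≤ 4 * C * r := by
  have h1 : ∑ i, (dotProduct (x i) w - dotProduct (x i) v) ^ 2
      ≤ 2 * ∑ i, (y i - dotProduct (x i) w) * dotProduct (x i) (v - w) := by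
    rw [Finset.mul_sum, ← sub_nonneg, ← Finset.sum_sub_distrib]
    rw [← sub_nonneg, ← Finset.sum_sub_distrib] at hmin
    refine hmin.trans (le_of_eq (Finset.sum_congr rfl fun i _ => ?_))
    rw [dotProduct_sub]
    ring
  have h2 : ∑ i, (y i - dotProduct (x i) w) * dotProduct (x i) (v - w)
      = ∑ k, (∑ i, (y i - dotProduct (x i) w) * x i k) * (v - w) k := by
    simp only [dotProduct, Finset.mul_sum, Finset.sum_mul]
    rw [Finset.sum_comm]
    simp only [mul_assoc]
  have h3 : ∑ k, (∑ i, (y i - dotProduct (x i) w) * x i k) * (v - w) k ≤ r * l1norm (v - w) := by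
    rw [l1norm, Finset.mul_sum]
    refine Finset.sum_le_sum fun k _ => (le_abs_self _).trans ?_
    rw [abs_mul]
    exact mul_le_mul_of_nonneg_right (hnoise k) (abs_nonneg _)
  have h4 : r * l1norm (v - w) ≤ r * (2 * C) :=
    mul_le_mul_of_nonneg_left ((l1norm_sub_le v w).trans (by linarith)) hr
  linarith

/-- Empirical second moments of linear functionals are uniformly close to the true ones as soon as
the Gram matrices are entrywise close. -/
theorem expect_sq_le_of_gram {T : Type*} {d n : ℕ} (p : PMF T)
    {ψ : T → Fin d → ℝ} (hψ : ∀ t, ‖ψ t‖ ≤ 1) {r : ℝ} (s : Fin n → T)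
    (hs : ∀ q : Fin d × Fin d,
      |∑ i, (ψ (s i) q.1 * ψ (s i) q.2 - p.expect fun t => ψ t q.1 * ψ t q.2)| ≤ n * r)
    (u : Fin d → ℝ) :
    n * p.expect (fun t => dotProduct (ψ t) u ^ 2)
      ≤ ∑ i, dotProduct (ψ (s i)) u ^ 2 + n * r * l1norm u ^ 2 := by
  have hB : ∀ k, IsBddFun fun t => ψ t k := fun k => ⟨1, fun t => (norm_le_pi_norm _ k).trans (hψ t)⟩
  -- The second moment is linear in the Gram matrix, with coefficients of total absolute value
  -- ‖u‖₁². Entrywise control is therefore uniform in u.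
  have e : ∀ t, dotProduct (ψ t) u ^ 2 = ∑ q : Fin d × Fin d, (u q.1 * u q.2) * (ψ t q.1 * ψ t q.2) := by
    intro t
    rw [pow_two, dotProduct, Finset.sum_mul_sum, Fintype.sum_prod_type]
    refine Finset.sum_congr rfl fun i _ => Finset.sum_congr rfl fun j _ => by ring
  have e2 : l1norm u ^ 2 = ∑ q : Fin d × Fin d, |u q.1 * u q.2| := by
    rw [pow_two, l1norm, Finset.sum_mul_sum, Fintype.sum_prod_type]
    simp only [abs_mul]
  simp only [e]
  rw [p.expect_finset_sum (F := fun (q : Fin d × Fin d) t => (u q.1 * u q.2) * (ψ t q.1 * ψ t q.2)) _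
    fun q _ => ((hB q.1).mul (hB q.2)).const_mul _]
  rw [Finset.sum_comm, e2, Finset.mul_sum, Finset.mul_sum, ← Finset.sum_add_distrib]
  refine Finset.sum_le_sum fun q _ => ?_
  rw [p.expect_const_mul, ← Finset.mul_sum]
  have h := hs q
  rw [Finset.sum_sub_distrib, Finset.sum_const, Finset.card_univ, Fintype.card_fin,
    nsmul_eq_mul] at h
  set a := ∑ i, ψ (s i) q.1 * ψ (s i) q.2
  set b := p.expect fun t => ψ t q.1 * ψ t q.2
  have h2 : (u q.1 * u q.2) * (n * b - a) ≤ |u q.1 * u q.2| * (n * r) := by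
    refine (le_abs_self _).trans ?_
    rw [abs_mul, abs_sub_comm]
    exact mul_le_mul_of_nonneg_left h (abs_nonneg _)
  linarith

/-! ### The regression problem -/

namespace LinearMDP

variable {X : Type u} {A : Type v} {d : ℕ} {M : LinearMDP X A d} {C : ℝ} {h : ℕ}

theorem exists_isRegressor [Fintype A] (M : LinearMDP X A d) (h : ℕ) {C : ℝ} (hC : 0 ≤ C) {n : ℕ}
    (c : Fin n → X × A × X) : ∃ what, M.IsRegressor h C c what := by
  have hne : ({w : Fin d → ℝ | l1norm w ≤ C}).Nonempty :=
    ⟨0, by simpa [l1norm] using hC⟩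
  have hcomp : IsCompact {w : Fin d → ℝ | l1norm w ≤ C} := by
    refine (isCompact_closedBall (0 : Fin d → ℝ) C).of_isClosed_subset
      (isClosed_le continuous_l1norm continuous_const) fun w hw => ?_
    rw [mem_closedBall_zero_iff, pi_norm_le_iff_of_nonneg hC]
    exact fun i => (abs_le_l1norm w i).trans hw
  have : ∀ l : Fin d, ∃ v : Fin d → ℝ, l1norm v ≤ C ∧ ∀ w : Fin d → ℝ, l1norm w ≤ C →
      ∑ i, (dotProduct (M.φ h (c i).1 (c i).2.1) v - M.φavg (h + 1) (c i).2.2 l) ^ 2 ≤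
        ∑ i, (dotProduct (M.φ h (c i).1 (c i).2.1) w - M.φavg (h + 1) (c i).2.2 l) ^ 2 := by
    intro l
    obtain ⟨v, hv, hmin⟩ := hcomp.exists_isMinOn hne
      (f := fun w => ∑ i, (dotProduct (M.φ h (c i).1 (c i).2.1) w
        - M.φavg (h + 1) (c i).2.2 l) ^ 2) (by
          unfold dotProduct
          fun_prop)
    exact ⟨v, hv, fun w hw => hmin hw⟩
  choose what hwhat using this
  exact ⟨what, hwhat⟩

theorem L1Bounded.abs_gram_le (hM : M.L1Bounded C) (hh : h < M.H) (q : Fin d × Fin d)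
    (s : X × A × X) : |M.φ h s.1 s.2.1 q.1 * M.φ h s.1 s.2.1 q.2| ≤ 1 := by
  rw [abs_mul]
  exact mul_le_one₀ (hM.abs_φ_le hh _ _ _) (abs_nonneg _) (hM.abs_φ_le hh _ _ _)

variable [Fintype A] [Nonempty A]

/-- The regression target: `⟨φ_h(x,a), w_l⟩` is the conditional expectation of the `l`-th
coordinate of the average features at the next state. -/
noncomputable def target (M : LinearMDP X A d) (h : ℕ) (l : Fin d) : Fin d → ℝ :=
  fun k => ∑' x', M.μ (h + 1) x' k * M.φavg (h + 1) x' l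

theorem L1Bounded.summable_target (hM : M.L1Bounded C) (hh : h + 1 < M.H) (l k : Fin d) :
    Summable fun x' => M.μ (h + 1) x' k * M.φavg (h + 1) x' l := by
  refine Summable.of_norm_bounded (hM.μ_summable h hh) fun x' => ?_
  rw [norm_mul, Real.norm_eq_abs, Real.norm_eq_abs]
  exact (mul_le_of_le_one_right (abs_nonneg _) (hM.abs_φavg_le hh x' l)).trans
    (abs_le_l1norm _ k)

/-- With v the mean feature of a policy, this reduces the infinite sum in the emulator condition to
one inner product. -/
theorem L1Bounded.tsum_eq_dot_target (hM : M.L1Bounded C) (hh : h + 1 < M.H) (l : Fin d)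
    (v : Fin d → ℝ) : ∑' x', dotProduct v (M.μ (h + 1) x') * M.φavg (h + 1) x' l
      = dotProduct v (M.target h l) := by
  simp only [dotProduct, target, Finset.sum_mul, mul_assoc]
  rw [Summable.tsum_finsetSum fun k _ => (hM.summable_target hh l k).mul_left _]
  simp only [tsum_mul_left]

/-- Makes the true coefficient vector admissible in the constrained regression, so the minimizers
can be compared with it. -/
theorem L1Bounded.l1norm_target_le (hM : M.L1Bounded C) (hh : h + 1 < M.H) (l : Fin d) :
    l1norm (M.target h l) ≤ C := by
  have h1 : ∀ k, Summable fun x' => |M.μ (h + 1) x' k| := fun k =>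
    Summable.of_nonneg_of_le (fun _ => abs_nonneg _) (fun x' => abs_le_l1norm _ k)
      (hM.μ_summable h hh)
  have h2 : ∀ k, |M.target h l k| ≤ ∑' x', |M.μ (h + 1) x' k| := by
    intro k
    have h3 := (hM.summable_target hh l k).norm
    refine (norm_tsum_le_tsum_norm h3).trans (h3.tsum_le_tsum (fun x' => ?_) (h1 k))
    rw [norm_mul, Real.norm_eq_abs, Real.norm_eq_abs]
    exact mul_le_of_le_one_right (abs_nonneg _) (hM.abs_φavg_le hh x' l)
  refine le_trans (Finset.sum_le_sum fun k _ => h2 k) ?_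
  rw [← Summable.tsum_finsetSum fun k _ => h1 k]
  exact hM.μ_le h hh

theorem L1Bounded.dot_target (hM : M.L1Bounded C) (hh : h + 1 < M.H) (l : Fin d) (x : X) (a : A) :
    dotProduct (M.φ h x a) (M.target h l)
      = (M.trans h x a).expect fun x' => M.φavg (h + 1) x' l := by
  rw [M.trans_expect hh, hM.tsum_eq_dot_target hh]

theorem L1Bounded.abs_dot_target_le (hM : M.L1Bounded C) (hh : h + 1 < M.H) (l : Fin d) (x : X)
    (a : A) : |dotProduct (M.φ h x a) (M.target h l)| ≤ 1 := by
  rw [hM.dot_target hh]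
  exact PMF.abs_expect_le _ fun x' => hM.abs_φavg_le hh x' l

/-- The product of the regression noise in coordinate `q.1` with the feature `q.2`. -/
noncomputable def noise (M : LinearMDP X A d) (h : ℕ) (q : Fin d × Fin d) (s : X × A × X) : ℝ :=
  (M.φavg (h + 1) s.2.2 q.1 - dotProduct (M.φ h s.1 s.2.1) (M.target h q.1))
    * M.φ h s.1 s.2.1 q.2

theorem L1Bounded.abs_noise_le (hM : M.L1Bounded C) (hh : h + 1 < M.H) (q : Fin d × Fin d)
    (s : X × A × X) : |M.noise h q s| ≤ 2 := by
  rw [noise, abs_mul]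
  have h1 := hM.abs_φavg_le hh s.2.2 q.1
  have h2 := hM.abs_dot_target_le hh q.1 s.1 s.2.1
  exact (mul_le_of_le_one_right (abs_nonneg _)
    (hM.abs_φ_le (Nat.lt_of_succ_lt hh) _ _ _)).trans ((abs_sub _ _).trans (by linarith))

theorem L1Bounded.expect_noise (hM : M.L1Bounded C) (hh : h + 1 < M.H)
    {Ψ : Finset (Policy X A)} (hΨ : Ψ.Nonempty) (q : Fin d × Fin d) :
    (M.sampleLaw h Ψ hΨ).expect (M.noise h q) = 0 := by
  have hb : IsBddFun fun x' => M.φavg (h + 1) x' q.1 := ⟨1, fun x' => hM.abs_φavg_le hh x' _⟩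
  rw [M.sampleLaw_expect hΨ ⟨2, hM.abs_noise_le hh q⟩]
  have h1 : ∀ x a, (M.trans h x a).expect (fun x' => M.noise h q (x, a, x')) = 0 := by
    intro x a
    simp only [noise, mul_comm _ (M.φ h x a q.2)]
    rw [PMF.expect_const_mul, PMF.expect_sub _ hb (.const _), PMF.expect_const,
      hM.dot_target hh, sub_self, mul_zero]
  simp only [h1, Finset.sum_const_zero, mul_zero, PMF.expect_const]

/-- The in-sample error of the regressors is small if the noise averages out. -/
theorem IsRegressor.sum_sq_le (hM : M.L1Bounded C) (hh : h + 1 < M.H) {n : ℕ}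
    {c : Fin n → X × A × X} {what : Fin d → Fin d → ℝ} (hw : M.IsRegressor h C c what) {r : ℝ}
    (hr : 0 ≤ r) (hnoise : ∀ q, |∑ i, M.noise h q (c i)| ≤ r) (l : Fin d) :
    ∑ i, (dotProduct (M.φ h (c i).1 (c i).2.1) (M.target h l)
      - dotProduct (M.φ h (c i).1 (c i).2.1) (what l)) ^ 2 ≤ 4 * C * r :=
  sum_sq_le_of_isMin (x := fun i => M.φ h (c i).1 (c i).2.1)
    (y := fun i => M.φavg (h + 1) (c i).2.2 l) (hw l).1 (hM.l1norm_target_le hh l) hr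
    ((hw l).2 _ (hM.l1norm_target_le hh l)) fun k => hnoise (l, k)

/-- Linear functionals that are small in empirical mean square are small in expectation under
every policy. -/
theorem PolicyCover.abs_meanφ_dot_le {Ψ : Finset (Policy X A)} {α : ℝ}
    (hcov : M.PolicyCover α h Ψ) (hΨ : Ψ.Nonempty) (hα : 0 < α) (hM : M.L1Bounded C)
    (hC : 1 ≤ C) (hh : h < M.H) {ζ : ℝ} (hζ : 0 < ζ) {u : Fin d → ℝ}
    (hu : (M.sampleLaw h Ψ hΨ).expect (fun s => dotProduct (M.φ h s.1 s.2.1) u ^ 2)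
      ≤ α * ζ ^ 2 / Fintype.card A) (π : Policy X A) :
    |dotProduct (M.meanφ π h) u| ≤ ζ := by
  have hA : (0 : ℝ) < Fintype.card A := by exact_mod_cast Fintype.card_pos
  have hb : IsBddFun fun s : X × A => dotProduct (M.φ h s.1 s.2) u :=
    ⟨_, fun s => hM.abs_dot_le hh _ _ _⟩
  have h1 : (M.saLaw π h).expect (fun s => dotProduct (M.φ h s.1 s.2) u ^ 2) ≤ ζ ^ 2 := by
    refine (hcov.expect_le' hΨ hα hM hC hh π hb.sq fun s => sq_nonneg _).trans ?_
    refine (mul_le_mul_of_nonneg_left hu (by positivity)).trans (le_of_eq ?_)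
    field_simp
  -- Cauchy–Schwarz through the pointwise bound e g ≤ g²/(2ζ) + ζ/2, for both signs e = ±1.
  have h2 : ∀ e : ℝ, |e| = 1 → e * dotProduct (M.meanφ π h) u ≤ ζ := by
    intro e he
    have he2 : e ^ 2 = 1 := by rw [← sq_abs, he, one_pow]
    rw [hM.meanφ_dot hh, ← PMF.expect_const_mul]
    calc (M.saLaw π h).expect (fun s => e * dotProduct (M.φ h s.1 s.2) u)
        ≤ (M.saLaw π h).expect
            (fun s => (1 / (2 * ζ)) * dotProduct (M.φ h s.1 s.2) u ^ 2 + ζ / 2) := by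
          refine PMF.expect_mono _ (hb.const_mul _) ((hb.sq.const_mul _).add (.const _))
            fun s => ?_
          set g := dotProduct (M.φ h s.1 s.2) u
          have h3 : (1 / (2 * ζ)) * g ^ 2 + ζ / 2 - e * g = (1 / (2 * ζ)) * (g - e * ζ) ^ 2 := by
            field_simp
            linear_combination -ζ ^ 2 * he2
          have h4 : 0 ≤ (1 / (2 * ζ)) * (g - e * ζ) ^ 2 := by positivity
          linarith
      _ ≤ (1 / (2 * ζ)) * ζ ^ 2 + ζ / 2 := by
          rw [PMF.expect_add _ (hb.sq.const_mul _) (.const _), PMF.expect_const,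
            PMF.expect_const_mul]
          gcongr
      _ = ζ := by field_simp; ring
  have h3 := h2 1 (by simp)
  have h4 := h2 (-1) (by simp)
  rw [abs_le]
  constructor <;> linarith

end LinearMDP

/-! ### Existence of an emulator by importance weighting -/

namespace LinearMDP

variable {X : Type u} {A : Type v} {d : ℕ} [Fintype A] [Nonempty A]
variable {M : LinearMDP X A d} {C : ℝ} {h : ℕ}

/-- Reweighting by the inverse of a discrete density. -/
theorem expect_div_density (p : PMF X) {B : ℝ} {g ν : X → ℝ} (hν : ∀ x, ν x ≤ B * (p x).toReal)
    (hg : ∀ x, |g x| ≤ ν x) : p.expect (fun x => g x / (p x).toReal) = ∑' x, g x := by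
  refine tsum_congr fun x => ?_
  rcases eq_or_ne (p x).toReal 0 with h0 | h0
  · have h1 := (hg x).trans (hν x)
    rw [h0, mul_zero] at h1
    rw [h0, zero_mul, abs_nonpos_iff.1 h1]
  · field_simp

theorem abs_div_density_le (p : PMF X) {B : ℝ} (hB : 0 ≤ B) {g ν : X → ℝ}
    (hν : ∀ x, ν x ≤ B * (p x).toReal) (hg : ∀ x, |g x| ≤ ν x) (x : X) :
    |g x / (p x).toReal| ≤ B := by
  rw [abs_div, abs_of_nonneg (ENNReal.toReal_nonneg (a := p x))]
  exact div_le_of_le_mul₀ ENNReal.toReal_nonneg hB ((hg x).trans (hν x))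

/-- With high probability over the sampled states, suitably rescaled importance weights turn the
true measures `μ_{h+1}` into a nonnegative emulator of bounded norm which is accurate on any given
finite set of state-action pairs. -/
theorem L1Bounded.iid_exists_emulator (hM : M.L1Bounded C) (hC : 1 ≤ C) (hh : h + 1 < M.H)
    (p : PMF X) {B : ℝ} (hB : 0 < B)
    (hν : ∀ x, l1norm (M.μ (h + 1) x) ≤ B * (p x).toReal) {n m : ℕ} (hm : 0 < m)
    (c : Fin n → X × A) {ε : ℝ} (hε : 0 < ε) :
    (p.iid m).toOuterMeasure {t | ¬ ∃ μhat : Fin m → Fin d → ℝ, ∑ j, l1norm (μhat j) ≤ C ∧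
        (∀ i j, 0 ≤ dotProduct (M.φ h (c i).1 (c i).2) (μhat j)) ∧
        ∀ i l, |dotProduct (M.φ h (c i).1 (c i).2) (M.target h l)
          - ∑ j, dotProduct (M.φ h (c i).1 (c i).2) (μhat j) * M.φavg (h + 1) (t j) l| ≤ ε / 2}
      ≤ ENNReal.ofReal ((2 * n * d + 1) * Real.exp (-(m * ε ^ 2 / (64 * B)))) := by
  have hmR : (0 : ℝ) < m := by exact_mod_cast hm
  have hlt := Nat.lt_of_succ_lt hh
  -- For ε ≥ 2 the zero emulator is already accurate, as the targets are at most 1. Otherwise ε < 2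
  -- makes the Bernstein parameter below admissible.
  rcases le_or_gt 2 ε with hε2 | hε2
  · refine le_trans (MeasureTheory.measure_mono (t := ∅) fun t ht => ht ⟨fun _ => 0, ?_, ?_, ?_⟩)
      (by simp)
    · simp only [l1norm, Pi.zero_apply, abs_zero, Finset.sum_const_zero]
      linarith
    · intro i j
      simp
    · intro i l
      simp only [dotProduct_zero, zero_mul, Finset.sum_const_zero, sub_zero]
      exact (hM.abs_dot_target_le hh l _ _).trans (by linarith)
  set β : ℝ := ε / 4 with hβ
  have hβ0 : 0 < β := by positivity
  set e : ℝ := Real.exp (-(m * ε ^ 2 / (64 * B))) with he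
  let Z : X → ℝ := fun x => l1norm (M.μ (h + 1) x) / (p x).toReal
  have hZ0 : ∀ x, 0 ≤ Z x := fun x => div_nonneg (l1norm_nonneg _) ENNReal.toReal_nonneg
  have habs1 : ∀ x, |l1norm (M.μ (h + 1) x)| ≤ l1norm (M.μ (h + 1) x) := fun x =>
    (abs_of_nonneg (l1norm_nonneg _)).le
  have hZB : ∀ x, |Z x| ≤ B := abs_div_density_le p hB.le hν habs1
  have hZbdd : IsBddFun Z := ⟨B, hZB⟩
  have hZE : p.expect Z ≤ C := (expect_div_density p hν habs1).trans_le (hM.μ_le h hh)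
  have hZV : p.expect (fun x => Z x ^ 2) ≤ B * C := by
    refine (p.expect_mono hZbdd.sq (hZbdd.const_mul B) fun x => ?_).trans ?_
    · rw [pow_two]
      exact mul_le_mul_of_nonneg_right ((le_abs_self _).trans (hZB x)) (hZ0 x)
    · rw [p.expect_const_mul]
      exact mul_le_mul_of_nonneg_left hZE hB.le
  -- The parameter β/(2B) maximizes qβ - q²B; the maximum β²/(4B) equals ε²/(64B).
  have hq0 : 0 < β / (2 * B) := by positivity
  have hqB : β / (2 * B) * B ≤ 1 := by
    rw [show β / (2 * B) * B = β / 2 by field_simp]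
    linarith
  have hZP : (p.iid m).toOuterMeasure {t | m * (C + β * C) ≤ ∑ j, Z (t j)}
      ≤ ENNReal.ofReal e := by
    refine (p.iid_bernstein hZB hZE hZV hq0 hqB m (β * C)).trans (ENNReal.ofReal_le_ofReal ?_)
    rw [he, Real.exp_le_exp, neg_le_neg_iff]
    rw [show (m : ℝ) * (β / (2 * B) * (β * C) - (β / (2 * B)) ^ 2 * (B * C))
      = (m * ε ^ 2 / (64 * B)) * C by rw [hβ]; field_simp; ring]
    exact le_mul_of_one_le_right (by positivity) hC
  let G : Fin n → X → ℝ := fun i x =>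
    dotProduct (M.φ h (c i).1 (c i).2) (M.μ (h + 1) x) / (p x).toReal
  have hG0 : ∀ i x, 0 ≤ G i x := fun i x =>
    div_nonneg (M.trans_nonneg h hh _ _ _) ENNReal.toReal_nonneg
  have hGB : ∀ i x, |G i x| ≤ B := fun i =>
    abs_div_density_le p hB.le hν fun x => hM.abs_dot_le hlt _ _ _
  have hGbdd : ∀ i, IsBddFun (G i) := fun i => ⟨B, hGB i⟩
  have hGE : ∀ i, p.expect (G i) = 1 := fun i =>
    (expect_div_density p hν fun x => hM.abs_dot_le hlt _ _ _).trans
      (M.trans_hasSum h hh _ _).tsum_eq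
  let Y : Fin n × Fin d → X → ℝ := fun q x => G q.1 x * M.φavg (h + 1) x q.2
  let f : Fin n × Fin d → ℝ := fun q =>
    dotProduct (M.φ h (c q.1).1 (c q.1).2) (M.target h q.2)
  have hYG : ∀ q x, |Y q x| ≤ G q.1 x := by
    intro q x
    rw [abs_mul, abs_of_nonneg (hG0 _ _)]
    exact mul_le_of_le_one_right (hG0 _ _) (hM.abs_φavg_le hh x _)
  have hYB : ∀ q x, |Y q x| ≤ B := fun q x => (hYG q x).trans ((le_abs_self _).trans (hGB _ x))
  have hYbdd : ∀ q, IsBddFun (Y q) := fun q => ⟨B, hYB q⟩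
  have hYE : ∀ q, p.expect (Y q) = f q := by
    intro q
    have h1 := expect_div_density p (g := fun x => dotProduct (M.φ h (c q.1).1 (c q.1).2)
      (M.μ (h + 1) x) * M.φavg (h + 1) x q.2) hν fun x => by
        rw [abs_mul]
        exact (mul_le_of_le_one_right (abs_nonneg _) (hM.abs_φavg_le hh x _)).trans
          (hM.abs_dot_le hlt _ _ _)
    rw [hM.tsum_eq_dot_target hh] at h1
    refine Eq.trans ?_ h1
    congr 1
    funext x
    exact div_mul_eq_mul_div _ _ _
  have hYV : ∀ q, p.expect (fun x => Y q x ^ 2) ≤ B := by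
    intro q
    refine (p.expect_mono (hYbdd q).sq ((hGbdd q.1).const_mul B) fun x => ?_).trans ?_
    · rw [← sq_abs, pow_two]
      exact mul_le_mul (hYB q x) (hYG q x) (abs_nonneg _) hB.le
    · rw [p.expect_const_mul, hGE, mul_one]
  have hexp : Real.exp (-((m : ℝ) * (β / (2 * B) * β - (β / (2 * B)) ^ 2 * B))) = e := by
    rw [he]
    congr 2
    rw [hβ]
    field_simp
    ring
  have hY1 : ∀ q, (p.iid m).toOuterMeasure {t | m * (f q + β) ≤ ∑ j, Y q (t j)}
      ≤ ENNReal.ofReal e := fun q =>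
    (p.iid_bernstein (hYB q) (hYE q).le (hYV q) hq0 hqB m β).trans_eq (by rw [hexp])
  have hY2 : ∀ q, (p.iid m).toOuterMeasure {t | m * (- f q + β) ≤ ∑ j, - Y q (t j)}
      ≤ ENNReal.ofReal e := fun q =>
    (p.iid_bernstein (f := fun x => - Y q x) (fun x => by rw [abs_neg]; exact hYB q x)
      (by rw [p.expect_neg, hYE]) (by simpa only [neg_sq] using hYV q)
      hq0 hqB m β).trans_eq (by rw [hexp])
  have he0 : 0 ≤ e := (Real.exp_pos _).le
  have hall := PMF.toOuterMeasure_union_le _ he0 (by positivity) hZP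
    (PMF.toOuterMeasure_union_le _ (by positivity) (by positivity)
      (PMF.toOuterMeasure_iUnion_le _ _ hY1) (PMF.toOuterMeasure_iUnion_le _ _ hY2))
  refine le_trans (MeasureTheory.measure_mono fun t ht => ?_) (hall.trans_eq ?_)
  swap
  · congr 1
    simp only [Fintype.card_prod, Fintype.card_fin]
    push_cast
    ring
  by_contra hbad
  simp only [Set.mem_union, Set.mem_iUnion, not_or, not_exists] at hbad
  obtain ⟨hb1, hb2, hb3⟩ := hbad
  have hb1 : ∑ j, Z (t j) < m * (C + β * C) := not_le.1 hb1
  have hb2 : ∀ q, ∑ j, Y q (t j) < m * (f q + β) := fun q => not_le.1 (hb2 q)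
  have hb3 : ∀ q, ∑ j, - Y q (t j) < m * (- f q + β) := fun q => not_le.1 (hb3 q)
  have hden : 0 < m * (1 + β) := by positivity
  -- The total norm before shrinking is below (1 + β)C, so division by 1 + β restores the bound C.
  -- Sampling and shrinking each cost at most β in accuracy, together ε/2.
  refine ht ⟨fun j => (1 / (m * (1 + β)) * (1 / (p (t j)).toReal)) • M.μ (h + 1) (t j),
    ?_, ?_, ?_⟩
  · have e1 : ∀ j, l1norm ((1 / (m * (1 + β)) * (1 / (p (t j)).toReal)) • M.μ (h + 1) (t j))
        = 1 / (m * (1 + β)) * Z (t j) := by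
      intro j
      rw [l1norm_smul, abs_of_nonneg (mul_nonneg (by positivity)
        (one_div_nonneg.2 ENNReal.toReal_nonneg))]
      simp only [Z]
      ring
    simp only [e1]
    rw [← Finset.mul_sum, one_div, inv_mul_le_iff₀ hden]
    exact hb1.le.trans_eq (by ring)
  · intro i j
    rw [dotProduct_smul]
    exact mul_nonneg (mul_nonneg (by positivity) (one_div_nonneg.2 ENNReal.toReal_nonneg))
      (M.trans_nonneg h hh _ _ _)
  · intro i l
    have e1 : ∑ j, dotProduct (M.φ h (c i).1 (c i).2)
        ((1 / (m * (1 + β)) * (1 / (p (t j)).toReal)) • M.μ (h + 1) (t j))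
          * M.φavg (h + 1) (t j) l = (∑ j, Y (i, l) (t j)) / (m * (1 + β)) := by
      rw [Finset.sum_div]
      refine Finset.sum_congr rfl fun j _ => ?_
      rw [dotProduct_smul, smul_eq_mul]
      simp only [Y, G]
      ring
    rw [e1]
    have h1 := hb2 (i, l)
    have h2 := hb3 (i, l)
    rw [Finset.sum_neg_distrib] at h2
    have h3 : |f (i, l)| ≤ 1 := hM.abs_dot_target_le hh l _ _
    obtain ⟨h4, h5⟩ := abs_le.1 h3
    show |f (i, l) - (∑ j, Y (i, l) (t j)) / (m * (1 + β))| ≤ ε / 2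
    generalize f (i, l) = z at *
    generalize ∑ j, Y (i, l) (t j) = S at *
    have hz : z - S / (m * (1 + β)) = (m * z * (1 + β) - S) / (m * (1 + β)) := by
      field_simp
    have hmβ : 0 < m * β := by positivity
    rw [hz, abs_div, abs_of_pos hden, div_le_iff₀ hden, abs_le,
      show ε / 2 = 2 * β by rw [hβ]; ring]
    have h6 := mul_le_mul_of_nonneg_left h4 hmβ.le
    have h7 := mul_le_mul_of_nonneg_left h5 hmβ.le
    have h8 : 0 ≤ m * β * β := by positivity
    constructor <;> nlinarith

end LinearMDP

/-! ### Convexity, feasibility and the emulator conditions -/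

namespace PMF

variable {T S : Type*}

/-- A union bound in which the second bad event may depend on the first sample, as its probability
is controlled uniformly in that sample. -/
theorem toOuterMeasure_bind_map_le (p : PMF T) (q : PMF S) {D : Set (T × S)} {E : Set T}
    {F : T → Set S} {a b : ℝ} (ha : 0 ≤ a) (hb : 0 ≤ b)
    (hE : p.toOuterMeasure E ≤ ENNReal.ofReal a)
    (hF : ∀ c, q.toOuterMeasure (F c) ≤ ENNReal.ofReal b)
    (hD : ∀ x ∈ D, x.1 ∈ E ∨ x.2 ∈ F x.1) :
    (p.bind fun c => q.map fun t => (c, t)).toOuterMeasure D ≤ ENNReal.ofReal (a + b) := by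
  rw [toOuterMeasure_bind_apply, ENNReal.ofReal_add ha hb]
  have h1 : ∀ c, p c * (q.map fun t => (c, t)).toOuterMeasure D
      ≤ E.indicator p c + p c * ENNReal.ofReal b := by
    intro c
    rw [toOuterMeasure_map_apply]
    by_cases hc : c ∈ E
    · rw [Set.indicator_of_mem hc]
      refine le_add_right ?_
      refine mul_le_of_le_one_right' ?_
      rw [toOuterMeasure_apply, ← q.tsum_coe]
      exact ENNReal.tsum_le_tsum fun t => Set.indicator_le_self _ _ _
    · rw [Set.indicator_of_notMem hc, zero_add]
      refine mul_le_mul_right ?_ _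
      refine le_trans (MeasureTheory.measure_mono fun t ht => ?_) (hF c)
      exact (hD _ ht).resolve_left hc
  refine (ENNReal.tsum_le_tsum h1).trans ?_
  rw [ENNReal.tsum_add, ENNReal.tsum_mul_right, p.tsum_coe, one_mul, ← toOuterMeasure_apply]
  exact add_le_add_left hE _

end PMF

namespace LinearMDP

variable {X : Type u} {A : Type v} {d : ℕ} {M : LinearMDP X A d} {C : ℝ} {h : ℕ}

theorem convex_feasible [Fintype A] (M : LinearMDP X A d) (h : ℕ) (ε C : ℝ) {n m : ℕ}
    (c : Fin n → X × A × X) (t : Fin m → X) (what : Fin d → Fin d → ℝ) :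
    Convex ℝ {μhat : Fin m → Fin d → ℝ | M.Feasible h ε C c t what μhat} := by
  intro x hx y hy a b ha hb hab
  have hdot : ∀ (v : Fin d → ℝ) j, dotProduct v ((a • x + b • y) j)
      = a * dotProduct v (x j) + b * dotProduct v (y j) := by
    intro v j
    rw [Pi.add_apply, Pi.smul_apply, Pi.smul_apply, dotProduct_add, dotProduct_smul,
      dotProduct_smul, smul_eq_mul, smul_eq_mul]
  refine ⟨?_, fun i j => ?_, fun l => ?_⟩
  · calc ∑ j, l1norm ((a • x + b • y) j) ≤ ∑ j, (a * l1norm (x j) + b * l1norm (y j)) := by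
          refine Finset.sum_le_sum fun j _ => ?_
          rw [Pi.add_apply, Pi.smul_apply, Pi.smul_apply]
          refine (l1norm_add_le _ _).trans ?_
          rw [l1norm_smul, l1norm_smul, abs_of_nonneg ha, abs_of_nonneg hb]
      _ = a * ∑ j, l1norm (x j) + b * ∑ j, l1norm (y j) := by
          rw [Finset.sum_add_distrib, Finset.mul_sum, Finset.mul_sum]
      _ ≤ a * C + b * C := by
          gcongr
          · exact hx.norm_le
          · exact hy.norm_le
      _ = C := by rw [← add_mul, hab, one_mul]
  · rw [hdot]
    exact add_nonneg (mul_nonneg ha (hx.nonneg i j)) (mul_nonneg hb (hy.nonneg i j))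
  · refine le_trans ?_ ((add_le_add (mul_le_mul_of_nonneg_left (hx.fit l) ha)
      (mul_le_mul_of_nonneg_left (hy.fit l) hb)).trans_eq (by rw [← add_mul, hab, one_mul]))
    rw [mul_left_comm a, mul_left_comm b, ← mul_add]
    refine mul_le_mul_of_nonneg_left ?_ (by positivity)
    rw [Finset.mul_sum, Finset.mul_sum, ← Finset.sum_add_distrib]
    refine Finset.sum_le_sum fun i _ => ?_
    simp only [hdot, add_mul, Finset.sum_add_distrib, mul_assoc, ← Finset.mul_sum]
    set w := dotProduct (M.φ h (c i).1 (c i).2.1) (what l)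
    set S := ∑ j, dotProduct (M.φ h (c i).1 (c i).2.1) (x j) * M.φavg (h + 1) (t j) l
    set R := ∑ j, dotProduct (M.φ h (c i).1 (c i).2.1) (y j) * M.φavg (h + 1) (t j) l
    obtain rfl : b = 1 - a := by linarith
    -- The convexity gap of the square is exactly ab(S - R)².
    nlinarith [mul_nonneg (mul_nonneg ha hb) (sq_nonneg (S - R))]

variable [Fintype A] [Nonempty A] {n m : ℕ} {c : Fin n → X × A × X} {t : Fin m → X}
  {what : Fin d → Fin d → ℝ} {μhat : Fin m → Fin d → ℝ} {ε : ℝ}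

/-- The fit error splits at the true target. By (a + b)² ≤ 2a² + 2b², regression and emulator each
use ε²/2 of the budget. -/
theorem IsRegressor.feasible (hM : M.L1Bounded C) (hC : 1 ≤ C) (hh : h + 1 < M.H) (hn : 0 < n)
    (hw : M.IsRegressor h C c what)
    (hnoise : ∀ q, |∑ i, M.noise h q (c i)| ≤ n * (ε ^ 2 / (16 * C)))
    (hnorm : ∑ j, l1norm (μhat j) ≤ C)
    (hnonneg : ∀ i j, 0 ≤ dotProduct (M.φ h (c i).1 (c i).2.1) (μhat j))
    (hfit : ∀ i l, |dotProduct (M.φ h (c i).1 (c i).2.1) (M.target h l)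
      - ∑ j, dotProduct (M.φ h (c i).1 (c i).2.1) (μhat j) * M.φavg (h + 1) (t j) l| ≤ ε / 2) :
    M.Feasible h ε C c t what μhat := by
  have hC0 : 0 < C := by linarith
  have hnR : (0 : ℝ) < n := by exact_mod_cast hn
  refine ⟨hnorm, hnonneg, fun l => ?_⟩
  have h1 := hw.sum_sq_le hM hh (by positivity) hnoise l
  rw [one_div, inv_mul_le_iff₀ hnR]
  calc _ ≤ ∑ i, (2 * (dotProduct (M.φ h (c i).1 (c i).2.1) (M.target h l)
          - dotProduct (M.φ h (c i).1 (c i).2.1) (what l)) ^ 2 + ε ^ 2 / 2) := by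
        refine Finset.sum_le_sum fun i _ => ?_
        have h2 := sq_le_sq' (abs_le.1 (hfit i l)).1 (abs_le.1 (hfit i l)).2
        set z := dotProduct (M.φ h (c i).1 (c i).2.1) (M.target h l)
        set y := dotProduct (M.φ h (c i).1 (c i).2.1) (what l)
        set S := ∑ j, dotProduct (M.φ h (c i).1 (c i).2.1) (μhat j) * M.φavg (h + 1) (t j) l
        nlinarith [sq_nonneg ((z - S) + (z - y))]
    _ ≤ 2 * (4 * C * (n * (ε ^ 2 / (16 * C)))) + n * (ε ^ 2 / 2) := by
        rw [Finset.sum_add_distrib, ← Finset.mul_sum, Finset.sum_const, Finset.card_univ,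
          Fintype.card_fin, nsmul_eq_mul]
        gcongr
    _ = n * ε ^ 2 := by
        field_simp
        ring

/-- The error is one functional, `target` minus v. Its second moment under the sampling law is at
most (3/4 + 3/2 + 1)ε², from regression, fit constraint and Gram deviation, which is below 4ε² =
αζ²/A. -/
theorem Feasible.apx_le (hM : M.L1Bounded C) (hC : 1 ≤ C) (hh : h + 1 < M.H) (hn : 0 < n)
    {Ψ : Finset (Policy X A)} {α ζ : ℝ} (hcov : M.PolicyCover α h Ψ) (hΨ : Ψ.Nonempty)
    (hα : 0 < α) (hζ : 0 < ζ) (hε : ε ^ 2 = α / (4 * Fintype.card A) * ζ ^ 2)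
    (hw : M.IsRegressor h C c what)
    (hnoise : ∀ q, |∑ i, M.noise h q (c i)| ≤ n * (ε ^ 2 / (16 * C)))
    (hgram : ∀ q : Fin d × Fin d, |∑ i, (M.φ h (c i).1 (c i).2.1 q.1 * M.φ h (c i).1 (c i).2.1 q.2
      - (M.sampleLaw h Ψ hΨ).expect fun s => M.φ h s.1 s.2.1 q.1 * M.φ h s.1 s.2.1 q.2)|
      ≤ n * (ε ^ 2 / (4 * C ^ 2)))
    (hf : M.Feasible h ε C c t what μhat) (π : Policy X A) (l : Fin d) :
    |∑' x, dotProduct (M.meanφ π h) (M.μ (h + 1) x) * M.φavg (h + 1) x l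
      - ∑ j, dotProduct (M.meanφ π h) (μhat j) * M.φavg (h + 1) (t j) l| ≤ ζ := by
  have hC0 : 0 < C := by linarith
  have hnR : (0 : ℝ) < n := by exact_mod_cast hn
  have hlt := Nat.lt_of_succ_lt hh
  have hA : (0 : ℝ) < Fintype.card A := by exact_mod_cast Fintype.card_pos
  set v : Fin d → ℝ := ∑ j, M.φavg (h + 1) (t j) l • μhat j with hv
  have hdv : ∀ x : Fin d → ℝ, dotProduct x v
      = ∑ j, dotProduct x (μhat j) * M.φavg (h + 1) (t j) l := by
    intro x
    rw [hv, dotProduct_sum]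
    refine Finset.sum_congr rfl fun j _ => ?_
    rw [dotProduct_smul, smul_eq_mul, mul_comm]
  have hvC : l1norm v ≤ C := by
    refine (l1norm_sum_le _ _).trans (le_trans (Finset.sum_le_sum fun j _ => ?_) hf.norm_le)
    rw [l1norm_smul]
    exact mul_le_of_le_one_left (l1norm_nonneg _) (hM.abs_φavg_le hh _ _)
  have huC : l1norm (M.target h l - v) ≤ 2 * C :=
    (l1norm_sub_le _ _).trans (by linarith [hM.l1norm_target_le hh l])
  rw [hM.tsum_eq_dot_target hh, ← hdv, ← dotProduct_sub]
  refine hcov.abs_meanφ_dot_le hΨ hα hM hC hlt hζ ?_ π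
  have h1 := hw.sum_sq_le hM hh (by positivity) hnoise l
  have h2 := hf.fit l
  rw [one_div, inv_mul_le_iff₀ hnR] at h2
  simp only [← hdv] at h2
  have h3 := expect_sq_le_of_gram (M.sampleLaw h Ψ hΨ) (fun s => hM.φ_le h hlt s.1 s.2.1) c hgram
    (M.target h l - v)
  have h4 : ∑ i, dotProduct (M.φ h (c i).1 (c i).2.1) (M.target h l - v) ^ 2
      ≤ 3 * (4 * C * (n * (ε ^ 2 / (16 * C)))) + 3 / 2 * (n * ε ^ 2) := by
    refine le_trans ?_ (add_le_add (mul_le_mul_of_nonneg_left h1 (by norm_num))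
      (mul_le_mul_of_nonneg_left h2 (by norm_num)))
    rw [Finset.mul_sum, Finset.mul_sum, ← Finset.sum_add_distrib]
    refine Finset.sum_le_sum fun i _ => ?_
    rw [dotProduct_sub]
    set z := dotProduct (M.φ h (c i).1 (c i).2.1) (M.target h l)
    set y := dotProduct (M.φ h (c i).1 (c i).2.1) (what l)
    set S := dotProduct (M.φ h (c i).1 (c i).2.1) v
    nlinarith [sq_nonneg (2 * (z - y) - (y - S))]
  have h5 : n * (ε ^ 2 / (4 * C ^ 2)) * l1norm (M.target h l - v) ^ 2 ≤ n * ε ^ 2 := by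
    have h6 : l1norm (M.target h l - v) ^ 2 ≤ (2 * C) ^ 2 :=
      pow_le_pow_left₀ (l1norm_nonneg _) huC 2
    refine (mul_le_mul_of_nonneg_left h6 (by positivity)).trans_eq ?_
    field_simp
    ring
  have h7 : 3 * (4 * C * (n * (ε ^ 2 / (16 * C)))) = 3 / 4 * (n * ε ^ 2) := by
    field_simp
    ring
  have h8 : α * ζ ^ 2 / Fintype.card A = 4 * ε ^ 2 := by
    rw [hε]
    field_simp
  rw [h8]
  refine le_of_mul_le_mul_left ?_ hnR
  have h9 : 0 ≤ n * ε ^ 2 := by positivity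
  linarith

-- The functional is at least -ε/2 off the margin set and at least -1 on it. Change of measure
-- bounds the mass of that set under any policy by (A/α) · αε/(2A) = ε/2.
open Classical in
theorem PolicyCover.neg_le_meanφ_dot (hM : M.L1Bounded C) (hC : 1 ≤ C) (hh : h < M.H)
    {Ψ : Finset (Policy X A)} {α : ℝ} (hcov : M.PolicyCover α h Ψ) (hΨ : Ψ.Nonempty)
    (hα : 0 < α) (hε : 0 < ε) {u : Fin d → ℝ} (hu : l1norm u = 1)
    (hmargin : (M.sampleLaw h Ψ hΨ).expect (fun s => M.weight h Ψ hΨ α s.1 *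
      if dotProduct (M.φ h s.1 s.2.1) u < -ε / 2 then 1 else 0)
        ≤ α * ε / (2 * Fintype.card A)) (π : Policy X A) :
    -ε ≤ dotProduct (M.meanφ π h) u := by
  have hA : (0 : ℝ) < Fintype.card A := by exact_mod_cast Fintype.card_pos
  have hb : IsBddFun fun s : X × A => dotProduct (M.φ h s.1 s.2) u :=
    ⟨_, fun s => hM.abs_dot_le hh _ _ _⟩
  have hi : IsBddFun fun s : X × A =>
      if dotProduct (M.φ h s.1 s.2) u < -ε / 2 then (1 : ℝ) else 0 := isBddFun_ite _
  have h1 := hcov.expect_le hΨ hα hM hC hh π hi fun s => by split_ifs <;> norm_num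
  have h2 := h1.trans (mul_le_mul_of_nonneg_left hmargin (by positivity))
  rw [show (Fintype.card A : ℝ) / α * (α * ε / (2 * Fintype.card A)) = ε / 2 by field_simp] at h2
  have h3 : (M.saLaw π h).expect (fun s =>
      -ε / 2 - if dotProduct (M.φ h s.1 s.2) u < -ε / 2 then (1 : ℝ) else 0)
      ≤ (M.saLaw π h).expect fun s => dotProduct (M.φ h s.1 s.2) u := by
    refine PMF.expect_mono _ ((IsBddFun.const _).sub hi) hb fun s => ?_
    have h4 := (abs_le.1 ((hM.abs_dot_le hh s.1 s.2 u).trans_eq hu)).1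
    split_ifs <;> linarith
  rw [PMF.expect_sub _ (.const _) hi, PMF.expect_const, ← hM.meanφ_dot hh] at h3
  linarith

end LinearMDP

/-! ### Numerical verification of the sample sizes -/

/-- Twice the logarithm yields (δ/(6d))², whose d⁻² pays for the union over pairs of coordinates. -/
theorem two_mul_sq_mul_exp_neg_le {d δ E : ℝ} (hd : 1 ≤ d) (hδ : 0 < δ) (hδ1 : δ < 1)
    (hE : 2 * Real.log (6 * d / δ) ≤ E) : d * d * (2 * Real.exp (-E)) ≤ δ / 4 := by
  have h1 : Real.exp (-E) ≤ (δ / (6 * d)) ^ 2 := by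
    calc Real.exp (-E) ≤ Real.exp (-(2 * Real.log (6 * d / δ))) := Real.exp_le_exp.2 (by linarith)
      _ = (δ / (6 * d)) ^ 2 := by
        rw [Real.exp_neg, mul_comm, Real.exp_mul, Real.exp_log (by positivity)]
        rw [Real.rpow_two, ← inv_pow, inv_div]
  calc d * d * (2 * Real.exp (-E)) ≤ d * d * (2 * (δ / (6 * d)) ^ 2) := by gcongr
    _ = δ ^ 2 / 18 := by field_simp; norm_num
    _ ≤ δ / 4 := by nlinarith

theorem log_six_mul_div_pos {d δ : ℝ} (hd : 1 ≤ d) (hδ : 0 < δ) (hδ1 : δ < 1) :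
    0 < Real.log (6 * d / δ) :=
  Real.log_pos (by rw [one_lt_div hδ]; linarith)

/-- The sample size suffices for the regression and second-moment bounds. -/
theorem hoeffding_exponent_le {d δ C A α ζ e n : ℝ} (hd : 1 ≤ d) (hδ : 0 < δ) (hδ1 : δ < 1)
    (hC : 1 ≤ C) (hA : 1 ≤ A) (hα : 0 < α) (hζ : 0 < ζ) (he : e = α / (4 * A) * ζ ^ 2)
    (hn : 100000 * (C ^ 4 * A ^ 2 * Real.log (6 * d / δ) / (α ^ 2 * ζ ^ 4)) ≤ n) :
    2 * Real.log (6 * d / δ) ≤ n * (e / (16 * C)) ^ 2 / 8 ∧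
      2 * Real.log (6 * d / δ) ≤ n * (e / (4 * C ^ 2)) ^ 2 / 8 := by
  have hL := log_six_mul_div_pos hd hδ hδ1
  set L := Real.log (6 * d / δ)
  have hC0 : 0 < C := by linarith
  have hA0 : 0 < A := by linarith
  have he0 : 0 < e := by rw [he]; positivity
  have h1 : 6250 * C ^ 4 * L ≤ n * e ^ 2 := by
    refine le_trans (le_of_eq ?_) (mul_le_mul_of_nonneg_right hn (sq_nonneg e))
    rw [he]
    field_simp
    norm_num
  have hC2 : 1 ≤ C ^ 2 := one_le_pow₀ hC
  constructor
  · rw [show n * (e / (16 * C)) ^ 2 / 8 = n * e ^ 2 / (2048 * C ^ 2) by field_simp; ring,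
      le_div_iff₀ (by positivity)]
    have : C ^ 2 * L ≤ C ^ 4 * L := by
      have : C ^ 2 ≤ C ^ 4 := pow_le_pow_right₀ hC (by norm_num)
      gcongr
    nlinarith [mul_nonneg (sq_nonneg C) hL.le]
  · rw [show n * (e / (4 * C ^ 2)) ^ 2 / 8 = n * e ^ 2 / (128 * C ^ 4) by field_simp; ring,
      le_div_iff₀ (by positivity)]
    have : 0 ≤ C ^ 4 * L := by positivity
    nlinarith

/-- The sample size suffices for the uniform margin bound. -/
theorem exists_margin_parameters {δ C A α ε n H : ℝ} {d : ℕ} (hd : 1 ≤ d) (hδ : 0 < δ)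
    (hδ1 : δ < 1) (hC : 1 ≤ C) (hA : 1 ≤ A) (hα : 0 < α) (hε : 0 < ε) (hε1 : ε < 1) (hH : 2 ≤ H)
    (hn : 100000 * (C ^ 2 * A * H ^ 3 * Real.log (8 * A * H * C / ε) * Real.log (12 * d / δ)
      / (α * ε ^ 4)) ≤ n) :
    ∃ k : ℕ, 96 * (α * C) * Real.exp (-(k * ε ^ 2 / 128)) ≤ α * ε / (2 * A) ∧
      Real.exp (-(n * (α * C))) + (2 * d) ^ k * Real.exp (-(n * (α * ε / (2 * A)) / 8))
        ≤ δ / 4 := by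
  have hC0 : 0 < C := by linarith
  have hA0 : 0 < A := by linarith
  have hH0 : 0 < H := by linarith
  have hd1 : (1 : ℝ) ≤ d := by exact_mod_cast hd
  have hd0 : (0 : ℝ) < d := by linarith
  set y := 8 * A * H * C / ε with hy
  have hy16 : 16 ≤ y := by
    rw [hy, le_div_iff₀ hε]
    nlinarith [mul_le_mul hA hH (by norm_num) hA0.le, mul_pos hA0 hH0,
      mul_le_mul_of_nonneg_left hC (mul_pos hA0 hH0).le]
  have hy0 : 0 < y := by linarith
  have hl1 : 1 ≤ Real.log y := by
    rw [Real.le_log_iff_exp_le hy0]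
    linarith [Real.exp_one_lt_d9]
  have hx0 : 0 < 12 * (d : ℝ) / δ := by positivity
  have hL1 : 1 ≤ Real.log (12 * d / δ) := by
    rw [Real.le_log_iff_exp_le hx0, le_div_iff₀ hδ]
    nlinarith [Real.exp_one_lt_d9, Real.exp_pos 1]
  set l := Real.log y with hl
  set L := Real.log (12 * d / δ) with hL
  have hlL : 1 ≤ l * L := one_le_mul_of_one_le_of_one_le hl1 hL1
  have hε2 : ε ^ 2 ≤ 1 := pow_le_one₀ hε.le hε1.le
  have hn1 : 100000 * (A * (l * L)) ≤ n * α * ε ^ 4 := by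
    have h1 : 100000 * (C ^ 2 * H ^ 3 * (A * (l * L))) ≤ n * α * ε ^ 4 := by
      rw [mul_assoc n]
      refine le_trans (le_of_eq ?_) (mul_le_mul_of_nonneg_right hn (by positivity))
      field_simp
    have h2 : 1 ≤ C ^ 2 * H ^ 3 := one_le_mul_of_one_le_of_one_le (one_le_pow₀ hC)
      (one_le_pow₀ (by linarith))
    have h3 := le_mul_of_one_le_left (show 0 ≤ A * (l * L) by positivity) h2
    linarith
  have hnα0 : 0 ≤ n * α := by
    have : 0 ≤ n * α * ε ^ 4 := le_trans (by positivity) hn1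
    exact nonneg_of_mul_nonneg_left this (by positivity)
  have hexpL : Real.exp (-L) = δ / (12 * d) := by
    rw [hL, Real.exp_neg, Real.exp_log hx0, inv_div]
  have hexpL' : Real.exp (-L) ≤ δ / 12 := by
    rw [hexpL]
    exact div_le_div_of_nonneg_left hδ.le (by norm_num) (by linarith)
  -- This k makes exp(-kε²/128) at most y⁻². The square leaves the ratio 3ε/(ACH²), which is below 1
  -- as H ≥ 2; α cancels.
  refine ⟨⌈256 * l / ε ^ 2⌉₊, ?_, ?_⟩
  · have hk : 256 * l / ε ^ 2 ≤ (⌈256 * l / ε ^ 2⌉₊ : ℝ) := Nat.le_ceil _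
    have h1 : 2 * l ≤ (⌈256 * l / ε ^ 2⌉₊ : ℝ) * ε ^ 2 / 128 := by
      rw [div_le_iff₀ (by positivity)] at hk
      linarith
    have h2 : Real.exp (-((⌈256 * l / ε ^ 2⌉₊ : ℝ) * ε ^ 2 / 128)) ≤ (ε / (8 * A * H * C)) ^ 2 := by
      calc _ ≤ Real.exp (-(2 * l)) := Real.exp_le_exp.2 (by linarith)
        _ = (ε / (8 * A * H * C)) ^ 2 := by
          rw [Real.exp_neg, mul_comm, Real.exp_mul, Real.exp_log hy0, Real.rpow_two, ← inv_pow,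
            hy, inv_div]
    calc 96 * (α * C) * Real.exp (-((⌈256 * l / ε ^ 2⌉₊ : ℝ) * ε ^ 2 / 128))
        ≤ 96 * (α * C) * (ε / (8 * A * H * C)) ^ 2 := by gcongr
      _ = (α * ε / (2 * A)) * (3 * ε / (A * C * H ^ 2)) := by field_simp; norm_num
      _ ≤ (α * ε / (2 * A)) * 1 := by
          gcongr
          rw [div_le_one (by positivity)]
          have : 1 ≤ A * C := one_le_mul_of_one_le_of_one_le hA hC
          nlinarith
      _ = α * ε / (2 * A) := mul_one _
  · have h1 : Real.exp (-(n * (α * C))) ≤ δ / 12 := by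
      refine le_trans (Real.exp_le_exp.2 (neg_le_neg ?_)) hexpL'
      have h3 : n * α * ε ^ 4 ≤ n * α := mul_le_of_le_one_right hnα0 (pow_le_one₀ hε.le hε1.le)
      have h4 : n * α ≤ n * (α * C) := by rw [← mul_assoc]; exact le_mul_of_one_le_right hnα0 hC
      have h5 : L ≤ l * L := le_mul_of_one_le_left (by linarith) hl1
      have h6 : l * L ≤ A * (l * L) := le_mul_of_one_le_left (by linarith) hA
      linarith
    have hk : (⌈256 * l / ε ^ 2⌉₊ : ℝ) ≤ 257 * l / ε ^ 2 := by
      refine (Nat.ceil_lt_add_one (by positivity)).le.trans ?_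
      rw [show 257 * l / ε ^ 2 = 256 * l / ε ^ 2 + l / ε ^ 2 by ring]
      gcongr
      rw [one_le_div (by positivity)]
      linarith
    have h2 : (2 * (d : ℝ)) ^ ⌈256 * l / ε ^ 2⌉₊ ≤ Real.exp (257 * l / ε ^ 2 * L) := by
      calc (2 * (d : ℝ)) ^ ⌈256 * l / ε ^ 2⌉₊ ≤ (12 * d / δ) ^ ⌈256 * l / ε ^ 2⌉₊ := by
            gcongr
            rw [le_div_iff₀ hδ]
            nlinarith
        _ = Real.exp (⌈256 * l / ε ^ 2⌉₊ * L) := by rw [Real.exp_nat_mul, hL, Real.exp_log hx0]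
        _ ≤ Real.exp (257 * l / ε ^ 2 * L) := by
            refine Real.exp_le_exp.2 (mul_le_mul_of_nonneg_right hk (by linarith))
    have h3 : 6250 * (l * L) / ε ^ 2 ≤ n * (α * ε / (2 * A)) / 8 := by
      rw [show n * (α * ε / (2 * A)) / 8 = n * α * ε / (16 * A) by field_simp; ring,
        div_le_div_iff₀ (by positivity) (by positivity)]
      have h4 : n * α * ε ^ 4 ≤ n * α * ε * ε ^ 2 := by
        rw [mul_assoc (n * α)]
        refine mul_le_mul_of_nonneg_left ?_ hnα0
        calc ε ^ 4 = ε ^ 3 * ε := by ring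
          _ ≤ ε ^ 3 * 1 := by gcongr
          _ = ε * ε ^ 2 := by ring
      linarith
    have h4 : (2 * (d : ℝ)) ^ ⌈256 * l / ε ^ 2⌉₊ * Real.exp (-(n * (α * ε / (2 * A)) / 8))
        ≤ δ / 12 := by
      refine le_trans (mul_le_mul_of_nonneg_right h2 (Real.exp_pos _).le) ?_
      rw [← Real.exp_add]
      refine le_trans (Real.exp_le_exp.2 ?_) hexpL'
      have h5 : L ≤ l * L / ε ^ 2 := by
        rw [le_div_iff₀ (by positivity)]
        have h6 : L ≤ l * L := le_mul_of_one_le_left (by linarith) hl1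
        nlinarith
      have h7 : 6250 * (l * L) / ε ^ 2 = 6250 * (l * L / ε ^ 2) := by ring
      have h8 : 257 * l / ε ^ 2 * L = 257 * (l * L / ε ^ 2) := by ring
      rw [h7] at h3
      rw [h8]
      have h9 : 0 ≤ l * L / ε ^ 2 := by positivity
      linarith
    linarith

/-- The number of sampled states suffices for the importance weighting bounds. -/
theorem bernstein_failure_le {δ A α η ζ e n d m : ℝ} (hd : 1 ≤ d) (hn : 1 ≤ n) (hδ : 0 < δ)
    (hδ1 : δ < 1) (hα : 0 < α) (hA : α ≤ A) (hη : 0 < η) (hζ : 0 < ζ)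
    (he : e = α / (4 * A) * ζ ^ 2)
    (hm : 100000 * (A ^ 3 * Real.log (12 * d * n / δ) / (α ^ 3 * η * ζ ^ 2)) ≤ m) :
    0 < m ∧ (2 * n * d + 1) * Real.exp (-(m * e / (64 * (A / (α * η))))) ≤ δ / 4 := by
  have hA0 : 0 < A := hα.trans_le hA
  have hdn : 1 ≤ d * n := one_le_mul_of_one_le_of_one_le hd hn
  have hx0 : 0 < 12 * d * n / δ := by positivity
  have hL : 0 < Real.log (12 * d * n / δ) := by
    apply Real.log_pos
    rw [one_lt_div hδ]
    nlinarith
  have hexpL : Real.exp (-Real.log (12 * d * n / δ)) = δ / (12 * d * n) := by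
    rw [Real.exp_neg, Real.exp_log hx0, inv_div]
  set L := Real.log (12 * d * n / δ)
  refine ⟨lt_of_lt_of_le (by positivity) hm, ?_⟩
  -- The exponent is a multiple of L · A/α, and α ≤ A. The 12 in the logarithm then turns the 2nd +
  -- 1 ≤ 3nd events into δ/4.
  have h1 : L ≤ m * e / (64 * (A / (α * η))) := by
    have h2 : m * e / (64 * (A / (α * η))) = m * (α ^ 2 * η * ζ ^ 2 / (256 * A ^ 2)) := by
      rw [he]
      field_simp
      ring
    rw [h2]
    refine le_trans ?_ (mul_le_mul_of_nonneg_right hm (by positivity))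
    have h3 : 100000 * (A ^ 3 * L / (α ^ 3 * η * ζ ^ 2)) * (α ^ 2 * η * ζ ^ 2 / (256 * A ^ 2))
        = (100000 / 256) * (L * (A / α)) := by
      field_simp
    rw [h3]
    have h4 := le_mul_of_one_le_right hL.le ((one_le_div hα).2 hA)
    linarith
  calc (2 * n * d + 1) * Real.exp (-(m * e / (64 * (A / (α * η)))))
      ≤ (3 * (d * n)) * Real.exp (-L) := by
        gcongr
        linarith
    _ = δ / 4 := by
        rw [hexpL]
        field_simp
        norm_num

/-! ### Good events and assembly -/

namespace LinearMDP

variable {X : Type u} {A : Type v} {d : ℕ} {M : LinearMDP X A d}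
  {C η : ℝ} {n m h : ℕ} {Ψ : Finset (Policy X A)} {ζ εneg α δ : ℝ}

/-- In dimension 0 every transition probability would be an empty sum and could not add up to 1. -/
theorem one_le_dim [Nonempty A] (M : LinearMDP X A d) (hh : h + 1 < M.H) : 1 ≤ d := by
  rcases Nat.eq_zero_or_pos d with rfl | hd
  · obtain ⟨x, -⟩ := M.init.support_nonempty
    have h1 := M.trans_hasSum h hh x (Classical.arbitrary A)
    simp only [dotProduct, Finset.univ_eq_empty, Finset.sum_empty] at h1
    exact absurd (h1.unique hasSum_zero) one_ne_zero
  · exact hd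

variable [Fintype A] [Nonempty A]

open Classical in
/-- The event that the first dataset violates one of the concentration bounds. -/
def badTransitions (M : LinearMDP X A d) (h : ℕ) (Ψ : Finset (Policy X A)) (hΨ : Ψ.Nonempty)
    (C ε εneg α : ℝ) (n : ℕ) : Set (Fin n → X × A × X) :=
  {c | ∃ q, n * (ε ^ 2 / (16 * C)) ≤ |∑ i, M.noise h q (c i)|} ∪
  ({c | ∃ q : Fin d × Fin d, n * (ε ^ 2 / (4 * C ^ 2)) ≤
    |∑ i, (M.φ h (c i).1 (c i).2.1 q.1 * M.φ h (c i).1 (c i).2.1 q.2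
      - (M.sampleLaw h Ψ hΨ).expect fun s => M.φ h s.1 s.2.1 q.1 * M.φ h s.1 s.2.1 q.2)|} ∪
  {c | εneg < 1 ∧ ∃ u, l1norm u = 1 ∧ (∀ i, 0 ≤ dotProduct (M.φ h (c i).1 (c i).2.1) u) ∧
    α * εneg / (2 * Fintype.card A) < (M.sampleLaw h Ψ hΨ).expect fun s =>
      M.weight h Ψ hΨ α s.1 * if dotProduct (M.φ h s.1 s.2.1) u < -εneg / 2 then 1 else 0})

/-- The event that the second dataset does not support an accurate emulator. -/
def badStates (M : LinearMDP X A d) (h : ℕ) (C ε : ℝ) (m : ℕ) (c : Fin n → X × A × X) :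
    Set (Fin m → X) :=
  {t | ¬ ∃ μhat : Fin m → Fin d → ℝ, ∑ j, l1norm (μhat j) ≤ C ∧
    (∀ i j, 0 ≤ dotProduct (M.φ h (c i).1 (c i).2.1) (μhat j)) ∧
    ∀ i l, |dotProduct (M.φ h (c i).1 (c i).2.1) (M.target h l)
      - ∑ j, dotProduct (M.φ h (c i).1 (c i).2.1) (μhat j) * M.φavg (h + 1) (t j) l| ≤ ε / 2}

theorem PolicyCover.badTransitions_le (hM : M.L1Bounded C) (hC : 1 ≤ C) (hh : h + 1 < M.H)
    (hεneg : 0 < εneg) (hζ : 0 < ζ) (hα : 0 < α) (hδ : 0 < δ) (hδ1 : δ < 1)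
    (hcov : M.PolicyCover α h Ψ) (hΨ : Ψ.Nonempty) (hn : 0 < n) {ε : ℝ} (hε : 0 < ε)
    (hεζ : ε ^ 2 = α / (4 * Fintype.card A) * ζ ^ 2)
    (hn1 : 100000 * (C ^ 2 * (Fintype.card A : ℝ) * (M.H : ℝ) ^ 3
      * Real.log (8 * (Fintype.card A : ℝ) * (M.H : ℝ) * C / εneg)
      * Real.log (12 * (d : ℝ) / δ) / (α * εneg ^ 4)) ≤ n)
    (hn2 : 100000 * (C ^ 4 * (Fintype.card A : ℝ) ^ 2 * Real.log (6 * (d : ℝ) / δ)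
      / (α ^ 2 * ζ ^ 4)) ≤ n) :
    ((M.sampleLaw h Ψ hΨ).iid n).toOuterMeasure (M.badTransitions h Ψ hΨ C ε εneg α n)
      ≤ ENNReal.ofReal (3 * δ / 4) := by
  have hlt := Nat.lt_of_succ_lt hh
  have hd : (1 : ℝ) ≤ d := by exact_mod_cast M.one_le_dim hh
  have hA : (1 : ℝ) ≤ Fintype.card A := by exact_mod_cast Fintype.card_pos
  have hC0 : 0 < C := by linarith
  have hδ4 : 0 ≤ δ / 4 := by positivity
  obtain ⟨hexp1, hexp2⟩ := hoeffding_exponent_le hd hδ hδ1 hC hA hα hζ hεζ hn2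
  have hcard : (Fintype.card (Fin d × Fin d) : ℝ) = d * d := by simp
  have h1 := ((M.sampleLaw h Ψ hΨ).iid_hoeffding_family (hM.abs_noise_le hh)
    (hM.expect_noise hh hΨ) n (show 0 < ε ^ 2 / (16 * C) by positivity)).trans
    (ENNReal.ofReal_le_ofReal (hcard ▸ two_mul_sq_mul_exp_neg_le hd hδ hδ1 hexp1))
  have hgb : ∀ q : Fin d × Fin d, IsBddFun fun s : X × A × X =>
      M.φ h s.1 s.2.1 q.1 * M.φ h s.1 s.2.1 q.2 := fun q => ⟨1, hM.abs_gram_le hlt q⟩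
  have h2 := ((M.sampleLaw h Ψ hΨ).iid_hoeffding_family (ι := Fin d × Fin d)
    (f := fun q s => M.φ h s.1 s.2.1 q.1 * M.φ h s.1 s.2.1 q.2
      - (M.sampleLaw h Ψ hΨ).expect fun s => M.φ h s.1 s.2.1 q.1 * M.φ h s.1 s.2.1 q.2)
    (fun q s => (abs_sub _ _).trans (by
      linarith [hM.abs_gram_le hlt q s,
        PMF.abs_expect_le (M.sampleLaw h Ψ hΨ) (hM.abs_gram_le hlt q)]))
    (fun q => by rw [PMF.expect_sub _ (hgb q) (.const _), PMF.expect_const, sub_self])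
    n (show 0 < ε ^ 2 / (4 * C ^ 2) by positivity)).trans
    (ENNReal.ofReal_le_ofReal (hcard ▸ two_mul_sq_mul_exp_neg_le hd hδ hδ1 hexp2))
  rw [show 3 * δ / 4 = δ / 4 + (δ / 4 + δ / 4) by ring]
  refine PMF.toOuterMeasure_union_le _ hδ4 (by positivity) h1
    (PMF.toOuterMeasure_union_le _ hδ4 hδ4 h2 ?_)
  by_cases hneg : εneg < 1
  · have hH : (2 : ℝ) ≤ M.H := by
      have : 2 ≤ M.H := by omega
      exact_mod_cast this
    obtain ⟨k, hk1, hk2⟩ := exists_margin_parameters (M.one_le_dim hh) hδ hδ1 hC hA hα hεneg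
      hneg hH hn1
    refine le_trans (MeasureTheory.measure_mono fun c hc => hc.2)
      ((margin_bound (M.sampleLaw h Ψ hΨ) (w := fun s => M.weight h Ψ hΨ α s.1)
        (ψ := fun s => M.φ h s.1 s.2.1) (fun s => M.weight_nonneg hΨ hα _)
        (fun s => hcov.weight_le_one hΨ hα _) (fun s => hM.φ_le h hlt _ _)
        (hcov.expect_weight_le hΨ hα hM hC hlt) hεneg hn hk1).trans
        (ENNReal.ofReal_le_ofReal hk2))
  · exact le_trans (MeasureTheory.measure_mono (t := ∅) fun c hc => hneg hc.1) (by simp)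

theorem PolicyCover.badStates_le (hM : M.L1Bounded C) (hC : 1 ≤ C) (hh : h + 1 < M.H)
    (hη : 0 < η) (hreach : M.Reachable η) (hζ : 0 < ζ) (hα : 0 < α) (hδ : 0 < δ) (hδ1 : δ < 1)
    (hcov : M.PolicyCover α h Ψ) (hΨ : Ψ.Nonempty) (hn : 0 < n) {ε : ℝ} (hε : 0 < ε)
    (hεζ : ε ^ 2 = α / (4 * Fintype.card A) * ζ ^ 2)
    (hm : 100000 * ((Fintype.card A : ℝ) ^ 3 * Real.log (12 * (d : ℝ) * (n : ℝ) / δ)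
      / (α ^ 3 * η * ζ ^ 2)) ≤ m) (c : Fin n → X × A × X) :
    ((M.nextLaw h Ψ hΨ).iid m).toOuterMeasure (M.badStates h C ε m c)
      ≤ ENNReal.ofReal (δ / 4) := by
  have hlt := Nat.lt_of_succ_lt hh
  have hd : (1 : ℝ) ≤ d := by exact_mod_cast M.one_le_dim hh
  have hA : (0 : ℝ) < Fintype.card A := by exact_mod_cast Fintype.card_pos
  have hnR : (1 : ℝ) ≤ n := by exact_mod_cast hn
  obtain ⟨hm0, hfail⟩ := bernstein_failure_le hd hnR hδ hδ1 hα
    (hcov.le_card hΨ hα hM hC hlt) hη hζ hεζ hm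
  refine (hM.iid_exists_emulator hC hh (M.nextLaw h Ψ hΨ)
    (B := Fintype.card A / (α * η)) (by positivity) (fun x => ?_) (by exact_mod_cast hm0)
    (fun i => ((c i).1, (c i).2.1)) hε).trans (ENNReal.ofReal_le_ofReal hfail)
  have h1 := hreach.mul_l1norm_le hcov hΨ hα hM hC hh x
  rw [← le_div_iff₀' hη] at h1
  refine h1.trans_eq ?_
  field_simp

theorem PolicyCover.isEmulator_of_feasible (hM : M.L1Bounded C) (hC : 1 ≤ C) (hh : h + 1 < M.H)
    (hεneg : 0 < εneg) (hζ : 0 < ζ) (hα : 0 < α) (hcov : M.PolicyCover α h Ψ) (hΨ : Ψ.Nonempty)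
    (hn : 0 < n) {ε : ℝ} (hεζ : ε ^ 2 = α / (4 * Fintype.card A) * ζ ^ 2)
    {c : Fin n → X × A × X} (hc : c ∉ M.badTransitions h Ψ hΨ C ε εneg α n)
    {t : Fin m → X} {what : Fin d → Fin d → ℝ} (hw : M.IsRegressor h C c what)
    {μhat : Fin m → Fin d → ℝ} (hf : M.Feasible h ε C c t what μhat) :
    M.IsEmulator h ζ εneg C μhat := by
  have hlt := Nat.lt_of_succ_lt hh
  simp only [badTransitions, Set.mem_union, not_or] at hc
  obtain ⟨hc1, hc2, hc3⟩ := hc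
  have hc1 : ∀ q, |∑ i, M.noise h q (c i)| ≤ n * (ε ^ 2 / (16 * C)) := fun q =>
    le_of_not_ge fun hq => hc1 ⟨q, hq⟩
  have hc2 := fun q => le_of_not_ge fun hq => hc2 ⟨q, hq⟩
  refine ⟨hf.norm_le, fun π j => ?_, t, fun π => ?_⟩
  · have hφ : |dotProduct (M.meanφ π h) (μhat j)| ≤ l1norm (μhat j) := by
      rw [hM.meanφ_dot hlt]
      exact PMF.abs_expect_le _ fun s => hM.abs_dot_le hlt _ _ _
    rcases (l1norm_nonneg (μhat j)).eq_or_lt with h0 | h0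
    · rw [← h0] at hφ
      rw [abs_nonpos_iff.1 hφ, ← h0, mul_zero, neg_zero]
    by_cases hneg : εneg < 1
    -- Sign constraint and conclusion are both homogeneous in the vector, so the normalized margin
    -- bound applies.
    · set u : Fin d → ℝ := (l1norm (μhat j))⁻¹ • μhat j with hu
      have hu1 : l1norm u = 1 := by
        rw [hu, l1norm_smul, abs_of_pos (inv_pos.2 h0), inv_mul_cancel₀ h0.ne']
      have hmar := le_of_not_gt fun hgt => hc3 ⟨hneg, u, hu1, fun i => by
        rw [hu, dotProduct_smul]
        exact mul_nonneg (inv_pos.2 h0).le (hf.nonneg i j), hgt⟩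
      have h1 := hcov.neg_le_meanφ_dot hM hC hlt hΨ hα hεneg hu1 hmar π
      rw [hu, dotProduct_smul, smul_eq_mul, le_inv_mul_iff₀ h0] at h1
      linarith
    · have h1 : 1 * l1norm (μhat j) ≤ εneg * l1norm (μhat j) :=
        mul_le_mul_of_nonneg_right (not_lt.1 hneg) h0.le
      linarith [(abs_le.1 hφ).1]
  · rw [pi_norm_le_iff_of_nonneg hζ.le]
    intro l
    exact hf.apx_le hM hC hh hn hcov hΨ hα hζ hεζ hw hc1 hc2 π l

end LinearMDP

theorem mainTheorem6 :
    ∃ C₀ : ℝ, 0 < C₀ ∧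
      ∀ (X : Type u) (A : Type v) [Fintype A] [Nonempty A] (d : ℕ) (M : LinearMDP X A d)
        (Cnrm η : ℝ), 1 ≤ Cnrm → M.L1Bounded Cnrm → 0 < η → M.Reachable η →
      ∀ (n m h : ℕ), h + 1 < M.H →
      ∀ (εneg εapx α δ : ℝ), 0 < εneg → 0 < εapx → 0 < α → 0 < δ →
      ∀ (Ψ : Finset (Policy X A)) (hΨ : Ψ.Nonempty), M.PolicyCover α h Ψ →
        C₀ * max
            (Cnrm ^ 2 * (Fintype.card A : ℝ) * (M.H : ℝ) ^ 3
                * Real.log (8 * (Fintype.card A : ℝ) * (M.H : ℝ) * Cnrm / εneg)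
                * Real.log (12 * (d : ℝ) / δ) / (α * εneg ^ 4))
            (Cnrm ^ 4 * (Fintype.card A : ℝ) ^ 2 * Real.log (6 * (d : ℝ) / δ)
                / (α ^ 2 * εapx ^ 4)) ≤ (n : ℝ) →
        C₀ * ((Fintype.card A : ℝ) ^ 3 * Real.log (12 * (d : ℝ) * (n : ℝ) / δ)
            / (α ^ 3 * η * εapx ^ 2)) ≤ (m : ℝ) →
        -- the program is convex, for any data
        (∀ (c : Fin n → X × A × X) (t : Fin m → X) (what : Fin d → Fin d → ℝ),
          Convex ℝ {μhat : Fin m → Fin d → ℝ |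
            M.Feasible h (Real.sqrt (α / (4 * (Fintype.card A : ℝ))) * εapx) Cnrm
              c t what μhat}) ∧
        -- with probability at least `1 - δ` over the datasets, it is feasible, and all its
        -- solutions are emulators
        ENNReal.ofReal (1 - δ) ≤ (M.drawData h Ψ hΨ n m).toOuterMeasure
          {D | (∃ what, M.IsRegressor h Cnrm D.1 what) ∧
            ∀ what, M.IsRegressor h Cnrm D.1 what →
              (∃ μhat : Fin m → Fin d → ℝ,
                M.Feasible h (Real.sqrt (α / (4 * (Fintype.card A : ℝ))) * εapx) Cnrm
                  D.1 D.2 what μhat) ∧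
              ∀ μhat : Fin m → Fin d → ℝ,
                M.Feasible h (Real.sqrt (α / (4 * (Fintype.card A : ℝ))) * εapx) Cnrm
                  D.1 D.2 what μhat →
                M.IsEmulator h εapx εneg Cnrm μhat} ∧
        -- in particular, emulators with `m` vectors exist
        (δ < 1 → ∃ μhat : Fin m → Fin d → ℝ, M.IsEmulator h εapx εneg Cnrm μhat) := by
  refine ⟨100000, by norm_num, ?_⟩
  intro X A _ _ d M C η hC hM hη hreach n m h hh εneg ζ α δ hεneg hζ hα hδ Ψ hΨ hcov hn hm
  refine ⟨fun c t what => LinearMDP.convex_feasible M h _ C c t what, ?_⟩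
  have hA : (0 : ℝ) < Fintype.card A := by exact_mod_cast Fintype.card_pos
  set ε := Real.sqrt (α / (4 * (Fintype.card A : ℝ))) * ζ with hε
  have hε0 : 0 < ε := mul_pos (Real.sqrt_pos.2 (by positivity)) hζ
  have hεζ : ε ^ 2 = α / (4 * Fintype.card A) * ζ ^ 2 := by
    rw [hε, mul_pow, Real.sq_sqrt (by positivity)]
  rcases le_or_gt 1 δ with hδ1 | hδ1
  · refine ⟨?_, fun h => absurd h (not_lt.2 hδ1)⟩
    rw [ENNReal.ofReal_of_nonpos (by linarith)]
    exact zero_le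
  have hd : (1 : ℝ) ≤ d := by exact_mod_cast M.one_le_dim hh
  have hn1 := (mul_le_mul_of_nonneg_left (le_max_left _ _) (by norm_num)).trans hn
  have hn2 := (mul_le_mul_of_nonneg_left (le_max_right _ _) (by norm_num)).trans hn
  have hn0 : 0 < n := by
    have hL := log_six_mul_div_pos hd hδ hδ1
    have hC0 : 0 < C := by linarith
    have : (0 : ℝ) < n := lt_of_lt_of_le (by positivity) hn2
    exact_mod_cast this
  have hB1 := hcov.badTransitions_le hM hC hh hεneg hζ hα hδ hδ1 hΨ hn0 hε0 hεζ hn1 hn2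
  have hB2 := hcov.badStates_le hM hC hh hη hreach hζ hα hδ hδ1 hΨ hn0 hε0 hεζ hm
  -- The existence claim is deduced from the probability bound: an event of positive probability
  -- contains a dataset.
  rw [and_iff_left_of_imp]
  · refine PMF.one_sub_le_toOuterMeasure _ _ hδ.le ?_
    -- Noise, Gram matrix and margin take δ/4 each in the transition data; the sampled states take
    -- the last quarter.
    rw [show δ = 3 * δ / 4 + δ / 4 by ring]
    refine PMF.toOuterMeasure_bind_map_le _ _ (by positivity) (by positivity) hB1 hB2
      fun D hD => ?_
    by_contra hgood
    rw [not_or] at hgood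
    obtain ⟨hg1, hg2⟩ := hgood
    refine hD ⟨M.exists_isRegressor h (by linarith) D.1, fun what hw =>
      ⟨?_, fun μhat hf => hcov.isEmulator_of_feasible hM hC hh hεneg hζ hα hΨ hn0 hεζ hg1 hw hf⟩⟩
    obtain ⟨μhat, hnorm, hnonneg, hfit⟩ := not_not.1 hg2
    refine ⟨μhat, hw.feasible hM hC hh hn0 (fun q => le_of_not_ge fun hq => hg1 ?_) hnorm
      hnonneg hfit⟩
    exact Or.inl ⟨q, hq⟩
  · intro hP _
    have hne : ENNReal.ofReal (1 - δ) ≠ 0 := by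
      rw [Ne, ENNReal.ofReal_eq_zero]
      linarith
    obtain ⟨D, ⟨what, hw⟩, hD⟩ := Set.nonempty_iff_ne_empty.2 fun h0 => hne (nonpos_iff_eq_zero.1
      (hP.trans_eq ((congrArg _ h0).trans MeasureTheory.measure_empty)))
    obtain ⟨⟨μhat, hf⟩, hall⟩ := hD what hw
    exact ⟨μhat, hall μhat hf⟩
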